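/- **Setting.** A conjunctive query (CQ) $Q(\vec Z) \,{:\!-}\, R_1(\vec X_1),\dots,R_\ell(\vec X_\ell)$ has a finite set $\vec Z$ of free variables, all occurring in its atoms; self-joins and repeated variables in an atom are allowed. It is *full* if every variable of its atoms is free; its size is measured by the number $\ell$ of atoms and their maximum arity. $Q$ is *acyclic* if it has a join tree, i.e. a tree whose nodes are the atoms and in which, for each variable, the atoms containing it form a connected subtree; $Q$ is *free-connex* if it is acyclic and remains acyclic after adding an atom whose variables are exactly $\vec Z$. A *selective commutative dioid* $(W,\oplus,\otimes,\bar 0,\bar 1)$ is a commutative semiring with $a\oplus b\in\{a,b\}$ for all $a,b$; it is totally ordered by $a\preceq b \iff a\oplus b=a$. A database $D$ consists of finite relations over a nonempty domain, each tuple carrying an input weight in $W$. A witness of an answer $q\in Q(D)$ is a vector $(t_1,\dots,t_\ell)$ of tuples, one from the relation of each atom, that join to produce $q$. Under *min-weight semantics* the weight of $q$ is the $\preceq$-least value of $w(t_1)\otimes\dots\otimes w(t_\ell)$ over all witnesses of $q$. *Ranked enumeration* of $Q$ on $D$ lists all answers of $Q(D)$ without repetition, with their weights, in $\preceq$-ascending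 order of weight (ties in any order). The model of computation is a random access machine with uniform cost, in which domain values can be copied, tested for equality and used in lookup tables with constant-time access, and $\oplus$, $\otimes$ and comparisons of weights take constant time. **Lemma (Free-connex CQ to full CQ).** For every $s\in\mathbb N$ there is a constant $C$ such that the following holds. For every free-connex CQ $Q$ with at most $s$ atoms, each of arity at most $s$, there are a full CQ $Q'$ with the same free variables, with at most $C$ atoms, each of arity at most $C$, and a program $P$, such that for every domain, every selective commutative dioid $W$, every $n\in\mathbb N$ and every weighted database $D$ in which the relations referenced by $Q$ have at most $n$ tuples each, there is a weighted database $D'$ for $Q'$ with at most $C n$ tuples in each relation for which 1. $P$ on input $D$ halts within $C(n+1)$ steps and outputs $D'$; and 2. ranked enumeration of $Q$ on $D$ under min-weight semantics and ranked enumeration of $Q'$ on $D'$ have the same outputs: a list of (answer, weight) pairs is a ranked enumeration of $Q$ on $D$ if and only if it is a ranked enumeration of $Q'$ on $D'$. In particular $Q(D)=Q'(D')$, with equal weights. -/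

import Mathlib

namespace RankedCQ

/-! ### Selective commutative dioids -/

/-- A selective commutative dioid: a commutative semiring (`⊕` is `+`, `⊗` is `*`) whose addition
always returns one of its two operands. -/
class SelectiveDioid (W : Type*) extends CommSemiring W where
  selective : ∀ a b : W, a + b = a ∨ a + b = b

/-- The total order induced by a selective dioid: `a ≼ b` iff `a ⊕ b = a`. -/
def Before {W : Type*} [SelectiveDioid W] (a b : W) : Prop := a + b = a

/-! ### Conjunctive queries -/

/-- A conjunctive query with set of free variables `Z`; variables are natural numbers.
Self-joins and repeated variables within an atom are allowed. -/
structure CQ (Z : Finset ℕ) where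
  /-- number of relation symbols -/
  numRel : ℕ
  arity : Fin numRel → ℕ
  numAtoms : ℕ
  /-- the relation symbol of each atom -/
  rel : Fin numAtoms → Fin numRel
  /-- the list of variables of each atom -/
  var : (i : Fin numAtoms) → Fin (arity (rel i)) → ℕ
  free_occurs : ∀ x ∈ Z, ∃ i c, var i c = x

namespace CQ

variable {Z : Finset ℕ} (Q : CQ Z)

/-- The hyperedge of an atom: the set of its variables. -/
def atomVars (i : Fin Q.numAtoms) : Finset ℕ := Finset.univ.image (Q.var i)

/-- A full query has no existential variable. -/
def IsFull : Prop := ∀ i, Q.atomVars i ⊆ Z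

/-- The query has at most `s` atoms, all of arity at most `s`. -/
def SizeAtMost (s : ℕ) : Prop := Q.numAtoms ≤ s ∧ ∀ i, Q.arity (Q.rel i) ≤ s

end CQ

/-- A hypergraph, given as a family of hyperedges, is (alpha-)acyclic if it has a join tree: a tree
whose nodes are the hyperedges such that, for every vertex `x`, the nodes that contain `x` form a
connected subtree. -/
def IsAcyclic {ι : Type*} (e : ι → Finset ℕ) : Prop :=
  ∃ T : SimpleGraph ι, T.IsTree ∧ ∀ x : ℕ, (T.induce {i | x ∈ e i}).Preconnected

/-- A query is free-connex if it is acyclic and remains acyclic when an atom that contains exactly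
the free variables is added. -/
def CQ.IsFreeConnex {Z : Finset ℕ} (Q : CQ Z) : Prop :=
  IsAcyclic Q.atomVars ∧
    IsAcyclic (fun o : Option (Fin Q.numAtoms) => o.elim Z Q.atomVars)

/-! ### Databases, answers and their ranking -/

/-- A finite `k`-ary relation over the domain `A`, listed in an array without repetition, together
with the input weight of each tuple. -/
structure WRel (A W : Type*) (k : ℕ) where
  card : ℕ
  row : Fin card → Fin k → A
  row_injective : Function.Injective row
  weight : Fin card → W

/-- A weighted database for the relation symbols of a query. -/
abbrev Database {Z : Finset ℕ} (Q : CQ Z) (A W : Type*) : Type _ :=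
  (j : Fin Q.numRel) → WRel A W (Q.arity j)

section Semantics

variable {Z : Finset ℕ} {A W : Type*} (Q : CQ Z) (D : Database Q A W)

/-- A choice of one input tuple for every atom. -/
abbrev Choice : Type := (i : Fin Q.numAtoms) → Fin (D (Q.rel i)).card

/-- The chosen tuples join and produce the answer `q`, i.e. they form a witness of `q`. -/
def IsWitness (q : Z → A) (t : Choice Q D) : Prop :=
  ∃ ν : ℕ → A, (∀ i c, (D (Q.rel i)).row (t i) c = ν (Q.var i c)) ∧ ∀ x : Z, ν x = q x

/-- The set `Q(D)` of query answers. -/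
def answers : Set (Z → A) := {q | ∃ t, IsWitness Q D q t}

variable [SelectiveDioid W]

/-- The weight of a witness: the `⊗`-aggregate of the weights of its tuples. -/
def witnessWeight (t : Choice Q D) : W := ∏ i, (D (Q.rel i)).weight (t i)

/-- Min-weight semantics: `w` is the least weight of a witness of `q`. -/
def IsMinWeight (q : Z → A) (w : W) : Prop :=
  (∃ t, IsWitness Q D q t ∧ witnessWeight Q D t = w) ∧
    ∀ t, IsWitness Q D q t → Before w (witnessWeight Q D t)

/-- `L` is an output of ranked enumeration: all the query answers, without repetition, each with its
weight under min-weight semantics, in ascending order of weight. -/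
structure IsRankedEnumeration (L : List ((Z → A) × W)) : Prop where
  nodup : (L.map Prod.fst).Nodup
  mem_iff : ∀ q, q ∈ L.map Prod.fst ↔ q ∈ answers Q D
  weight : ∀ p ∈ L, IsMinWeight Q D p.1 p.2
  sorted : (L.map Prod.snd).Pairwise Before

end Semantics

/-! ### Random access machines

Structured programs for a random access machine with uniform cost. The memory consists of an array
of natural numbers (which serve as registers, counters and addresses), an array of domain values
and an array of weights. Domain values can only be copied, compared for equality and used as keys
of a lookup table; weights can only be combined by the operations of the dioid and compared. The
lookup table has constant access time, with keys that consist of a number and a domain value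
(tuples are looked up one component at a time). The input database is in read-only memory with
random access, and the tuples of the output database are appended to the output. -/

/-- A machine state. -/
structure State (A W : Type*) where
  num : ℕ → ℕ
  val : ℕ → A
  wt : ℕ → W
  /-- the lookup table; unused keys are mapped to `0` -/
  tab : ℕ → A → ℕ
  /-- for each output relation, the tuples written so far and their weights -/
  out : ℕ → List (List A × W)

/-- The initial state. -/
noncomputable def State.start (A W : Type*) [Nonempty A] [SelectiveDioid W] : State A W where
  num _ := 0
  val _ := Classical.arbitrary A
  wt _ := 0
  tab _ _ := 0
  out _ := []

/-- Machine instructions. Below, `N`, `V`, `X`, `T` are the arrays of numbers, values and weights,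
and the lookup table. -/
inductive Instr where
  /-- `N[r] := k` -/
  | const (r k : ℕ)
  /-- `N[r] := N[a] + N[b]` -/
  | add (r a b : ℕ)
  /-- `N[r] := N[a] - N[b]` (truncated) -/
  | sub (r a b : ℕ)
  /-- `N[r] := N[N[a]]` -/
  | load (r a : ℕ)
  /-- `N[N[r]] := N[a]` -/
  | store (r a : ℕ)
  /-- `V[N[r]] := V[N[a]]` -/
  | copyVal (r a : ℕ)
  /-- `X[N[r]] := X[N[a]]` -/
  | copyWt (r a : ℕ)
  /-- `X[N[r]] := 1` -/
  | oneWt (r : ℕ)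
  /-- `X[N[r]] := 0` -/
  | zeroWt (r : ℕ)
  /-- `X[N[r]] := X[N[a]] ⊗ X[N[b]]` -/
  | mulWt (r a b : ℕ)
  /-- `X[N[r]] := X[N[a]] ⊕ X[N[b]]` -/
  | addWt (r a b : ℕ)
  /-- `T[N[r], V[N[a]]] := N[b]` -/
  | put (r a b : ℕ)
  /-- `N[r] := T[N[a], V[N[b]]]` -/
  | get (r a b : ℕ)
  /-- `N[r] :=` the number of tuples of input relation `j` -/
  | inCard (r j : ℕ)
  /-- `V[N[r]] :=` component `c` of tuple number `N[a]` of input relation `j` -/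
  | inVal (r j a c : ℕ)
  /-- `X[N[r]] :=` the weight of tuple number `N[a]` of input relation `j` -/
  | inWt (r j a : ℕ)
  /-- append the tuple `V[N[r]], …, V[N[r] + k - 1]` with weight `X[N[a]]` to output relation `j` -/
  | emit (j k r a : ℕ)

/-- Every instruction takes one step, except that writing a `k`-tuple takes `k + 1` steps. -/
def Instr.cost : Instr → ℕ
  | .emit _ k _ _ => k + 1
  | _ => 1

/-- Tests, each of which takes one step. -/
inductive Test where
  /-- `N[a] = N[b]` -/
  | eqNum (a b : ℕ)
  /-- `N[a] < N[b]` -/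
  | ltNum (a b : ℕ)
  /-- `V[N[a]] = V[N[b]]` -/
  | eqVal (a b : ℕ)
  /-- `X[N[a]] ≼ X[N[b]]` -/
  | leWt (a b : ℕ)

/-- Programs. -/
inductive Prog where
  | skip
  | op (i : Instr)
  | seq (p q : Prog)
  | ite (b : Test) (p q : Prog)
  | loop (b : Test) (p : Prog)

section Machine

variable {Z : Finset ℕ} {A W : Type*} {Q : CQ Z} [SelectiveDioid W]

/-- The truth value of a test. -/
def Test.Holds (σ : State A W) : Test → Prop
  | .eqNum a b => σ.num a = σ.num b
  | .ltNum a b => σ.num a < σ.num b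
  | .eqVal a b => σ.val (σ.num a) = σ.val (σ.num b)
  | .leWt a b => Before (σ.wt (σ.num a)) (σ.wt (σ.num b))

open Classical in
/-- The effect of an instruction on input database `D`. Reading outside the input has no effect. -/
noncomputable def Instr.run (D : Database Q A W) (σ : State A W) : Instr → State A W
  | .const r k => { σ with num := Function.update σ.num r k }
  | .add r a b => { σ with num := Function.update σ.num r (σ.num a + σ.num b) }
  | .sub r a b => { σ with num := Function.update σ.num r (σ.num a - σ.num b) }
  | .load r a => { σ with num := Function.update σ.num r (σ.num (σ.num a)) }
  | .store r a => { σ with num := Function.update σ.num (σ.num r) (σ.num a) }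
  | .copyVal r a => { σ with val := Function.update σ.val (σ.num r) (σ.val (σ.num a)) }
  | .copyWt r a => { σ with wt := Function.update σ.wt (σ.num r) (σ.wt (σ.num a)) }
  | .oneWt r => { σ with wt := Function.update σ.wt (σ.num r) 1 }
  | .zeroWt r => { σ with wt := Function.update σ.wt (σ.num r) 0 }
  | .mulWt r a b =>
      { σ with wt := Function.update σ.wt (σ.num r) (σ.wt (σ.num a) * σ.wt (σ.num b)) }
  | .addWt r a b =>
      { σ with wt := Function.update σ.wt (σ.num r) (σ.wt (σ.num a) + σ.wt (σ.num b)) }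
  | .put r a b =>
      { σ with
        tab := Function.update σ.tab (σ.num r)
          (Function.update (σ.tab (σ.num r)) (σ.val (σ.num a)) (σ.num b)) }
  | .get r a b =>
      { σ with num := Function.update σ.num r (σ.tab (σ.num a) (σ.val (σ.num b))) }
  | .inCard r j =>
      if h : j < Q.numRel then { σ with num := Function.update σ.num r (D ⟨j, h⟩).card } else σ
  | .inVal r j a c =>
      if h : j < Q.numRel then
        if h' : σ.num a < (D ⟨j, h⟩).card ∧ c < Q.arity ⟨j, h⟩ then
          { σ with
            val := Function.update σ.val (σ.num r) ((D ⟨j, h⟩).row ⟨σ.num a, h'.1⟩ ⟨c, h'.2⟩) }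
        else σ
      else σ
  | .inWt r j a =>
      if h : j < Q.numRel then
        if h' : σ.num a < (D ⟨j, h⟩).card then
          { σ with wt := Function.update σ.wt (σ.num r) ((D ⟨j, h⟩).weight ⟨σ.num a, h'⟩) }
        else σ
      else σ
  | .emit j k r a =>
      { σ with
        out := Function.update σ.out j
          (σ.out j ++ [((List.range k).map fun c => σ.val (σ.num r + c), σ.wt (σ.num a))]) }

/-- `Exec D p σ τ t`: on input database `D`, the program `p` started in state `σ` halts in state `τ`
after `t` steps. -/
inductive Exec (D : Database Q A W) : Prog → State A W → State A W → ℕ → Prop where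
  | skip (σ : State A W) : Exec D .skip σ σ 1
  | op (i : Instr) (σ : State A W) : Exec D (.op i) σ (i.run D σ) i.cost
  | seq {p q : Prog} {σ τ ρ : State A W} {s t : ℕ} :
      Exec D p σ τ s → Exec D q τ ρ t → Exec D (.seq p q) σ ρ (s + t)
  | ite_true {b : Test} {p q : Prog} {σ τ : State A W} {t : ℕ} :
      b.Holds σ → Exec D p σ τ t → Exec D (.ite b p q) σ τ (t + 1)
  | ite_false {b : Test} {p q : Prog} {σ τ : State A W} {t : ℕ} :
      ¬ b.Holds σ → Exec D q σ τ t → Exec D (.ite b p q) σ τ (t + 1)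
  | loop_true {b : Test} {p : Prog} {σ τ ρ : State A W} {s t : ℕ} :
      b.Holds σ → Exec D p σ τ s → Exec D (.loop b p) τ ρ t →
        Exec D (.loop b p) σ ρ (s + t + 1)
  | loop_false {b : Test} {p : Prog} {σ : State A W} :
      ¬ b.Holds σ → Exec D (.loop b p) σ σ 1

/-- The output written in state `σ` is the weighted database `D`. -/
def Outputs (σ : State A W) (D : Database Q A W) : Prop :=
  ∀ j : Fin Q.numRel,
    σ.out j = List.ofFn fun i => (List.ofFn ((D j).row i), (D j).weight i)

/-- On input database `D`, the program `p` halts within `t` steps and outputs the database `D'`. -/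
def Computes {Q' : CQ Z} [Nonempty A] (p : Prog) (D : Database Q A W) (D' : Database Q' A W)
    (t : ℕ) : Prop :=
  ∃ σ : State A W, ∃ t' ≤ t, Exec D p (State.start A W) σ t' ∧ Outputs σ D'

end Machine

end RankedCQ

open RankedCQ

/-! Adding the hyperedge `Z` to the atoms leaves a join tree, which is rooted at `Z`. Each atom `i`
sends a message to its parent: a partial function that maps values of the variables shared with the
parent to the least weight of a choice of tuples, one from each atom below and including `i`, that
join and extend these values. Since `⊗` is monotone for `≼`, these minima can be computed bottom-up:
a tuple contributes its own weight times the messages of the children at the matching keys, and the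
message is the `⊕` of the contributions with the same key. Messages take values in `Option W`
because `0` may be a genuine weight and cannot stand for absence. The variables shared with the root
are all free, so the messages of the children of the root are the relations of a full query,
`fullQuery`.

A witness of `Q` yields a witness of `fullQuery` that is no heavier (`exists_full_witness`).
Conversely, selectivity of `⊕` means that each message value is attained by a single tuple; choosing
attaining tuples from the root downwards gives a witness of `Q` of exactly the same weight
(`exists_witness`), and the running intersection property glues the tuples into one assignment.
Hence answers and minimal weights agree (`isRankedEnumeration_iff`).

For linear time, the messages are stored in tries inside the lookup table, one trie per atom, with
the weight at the end node of each key. Handling one tuple then takes a number of steps that depends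
on `s` only (`reach_processTuple`, `reach_emitTuple`). The invariants `Represents` and `Emitted`
relate machine states to the messages. -/

namespace RankedCQ

/-! ### Rooted join trees -/

/-- A join tree of the hyperedges `e` and `Z`, rooted at `Z`. The parent of a hyperedge is `none` if
it is a child of the root. -/
structure RootedJoinTree {m : ℕ} (e : Fin m → Finset ℕ) (Z : Finset ℕ) where
  par : Fin m → Option (Fin m)
  depth : Fin m → ℕ
  depth_root : ∀ i, par i = none → depth i = 0
  depth_child : ∀ i p, par i = some p → depth i = depth p + 1
  -- Connectedness of the nodes containing `x`, phrased as an induction principle: a property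
  -- invariant along the child-parent edges between such nodes is constant on them. This avoids
  -- handling walks later.
  running : ∀ (x : ℕ) (P : Option (Fin m) → Prop),
    (∀ i, x ∈ e i → x ∈ (par i).elim Z e → (P (some i) ↔ P (par i))) →
    ∀ u v : Option (Fin m), x ∈ u.elim Z e → x ∈ v.elim Z e → P u → P v

/-- The parent is the second vertex on the path from `v` to the root `r`. It is the only neighbour
nearer to `r` because paths in a tree are unique. -/
theorem exists_parent {V : Type*} {T : SimpleGraph V} (hT : T.IsTree) (r v : V) (hv : v ≠ r) :
    ∃ p, T.Adj v p ∧ T.dist r v = T.dist r p + 1 ∧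
      ∀ u, T.Adj v u → T.dist r v = T.dist r u + 1 → u = p := by
  obtain ⟨w, hw, hl⟩ := hT.connected.exists_path_of_dist v r
  cases w with
  | nil => exact absurd rfl hv
  | @cons _ p _ h w =>
    have hd : T.dist r v = T.dist r p + 1 := by
      have h1 : T.dist p r ≤ w.length := SimpleGraph.dist_le w
      have h2 : w.length + 1 = T.dist v r := by simpa using hl
      rcases hT.dist_eq_dist_add_one_of_adj r h with h3 | h3 <;>
        rw [T.dist_comm (u := r), T.dist_comm (u := r)] at * <;> omega
    refine ⟨p, h, hd, fun u hu hdu => ?_⟩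
    obtain ⟨w', -, hl'⟩ := hT.connected.exists_path_of_dist u r
    -- A shortest walk from `u`, prolonged by the edge from `v`, has length equal to the distance
    -- and is therefore a path.
    have hp : (SimpleGraph.Walk.cons hu w').IsPath := by
      apply SimpleGraph.Walk.isPath_of_length_eq_dist
      rw [SimpleGraph.Walk.length_cons, hl', T.dist_comm, T.dist_comm (u := v), hdu]
    have := (hT.existsUnique_path v r).unique hp hw
    simpa using congrArg SimpleGraph.Walk.snd this

theorem exists_rootedJoinTree {m : ℕ} {e : Fin m → Finset ℕ} {Z : Finset ℕ}
    (h : IsAcyclic (fun o : Option (Fin m) => o.elim Z e)) : Nonempty (RootedJoinTree e Z) := by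
  obtain ⟨T, hT, hc⟩ := h
  choose par hadj hdist huniq using fun i : Fin m => exists_parent hT none (some i) (by simp)
  -- The depth is the distance from the parent to the root, so that children of the root have depth
  -- `0`.
  refine ⟨⟨par, fun i => T.dist none (par i), ?_, ?_, ?_⟩⟩
  · intro i hi; simp [hi]
  · intro i p hp
    simp only [hp]
    rw [hdist p]
  · intro x P hP u v hu hv hPu
    -- Adjacent vertices of a tree differ by one in distance from the root, so every edge joins a
    -- node to its parent.
    have key : ∀ a b : Option (Fin m), T.Adj a b → x ∈ a.elim Z e → x ∈ b.elim Z e →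
        (P a ↔ P b) := by
      intro a b hab ha hb
      rcases hT.dist_eq_dist_add_one_of_adj none hab with h | h
      · cases a with
        | none => simp at h
        | some i =>
          obtain rfl := huniq i b hab h
          exact hP i ha hb
      · cases b with
        | none => simp at h
        | some i =>
          obtain rfl := huniq i a hab.symm h
          exact (hP i hb ha).symm
    obtain ⟨w⟩ := hc x ⟨u, hu⟩ ⟨v, hv⟩
    have : ∀ a b : {i : Option (Fin m) | x ∈ i.elim Z e},
        (T.induce {i : Option (Fin m) | x ∈ i.elim Z e}).Walk a b → P a → P b := by
      intro a b w
      induction w with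
      | nil => exact id
      | @cons a b c h _ ih => exact fun ha => ih ((key a b h a.2 b.2).1 ha)
    exact this _ _ w hPu

/-! ### Selective dioids -/

section Dioid

variable {W : Type*} [SelectiveDioid W]

theorem Before.refl (a : W) : Before a a := by
  rcases SelectiveDioid.selective a a with h | h <;> exact h

theorem Before.trans {a b c : W} (h₁ : Before a b) (h₂ : Before b c) : Before a c := by
  unfold Before at *
  rw [← h₁, add_assoc, h₂]

theorem Before.antisymm {a b : W} (h₁ : Before a b) (h₂ : Before b a) : a = b := by
  unfold Before at *
  rw [← h₁, add_comm, h₂]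

theorem Before.mul {a b c d : W} (h₁ : Before a b) (h₂ : Before c d) : Before (a * c) (b * d) := by
  refine Before.trans (b := b * c) ?_ ?_
  · unfold Before at *
    rw [← add_mul, h₁]
  · unfold Before at *
    rw [← mul_add, h₂]

theorem before_add_left (a b : W) : Before (a + b) a := by
  unfold Before
  rw [add_right_comm, Before.refl a]

theorem before_add_right (a b : W) : Before (a + b) b := by
  rw [add_comm]; exact before_add_left b a

end Dioid

/-! ### Elimination of a rooted join tree -/

namespace RootedJoinTree

variable {m : ℕ} {e : Fin m → Finset ℕ} {Z : Finset ℕ} (J : RootedJoinTree e Z)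

/-- The variables that a hyperedge shares with its parent. -/
noncomputable def sep (i : Fin m) : List ℕ := (e i ∩ (J.par i).elim Z e).toList

/-- The children of a hyperedge. -/
noncomputable def kids (i : Fin m) : List (Fin m) :=
  (Finset.univ.filter fun j => J.par j = some i).toList

theorem mem_sep {i : Fin m} {x : ℕ} : x ∈ J.sep i ↔ x ∈ e i ∧ x ∈ (J.par i).elim Z e := by
  simp [sep]

theorem mem_kids {i j : Fin m} : j ∈ J.kids i ↔ J.par j = some i := by simp [kids]

theorem length_kids_le (i : Fin m) : (J.kids i).length ≤ m := by
  rw [kids, Finset.length_toList]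
  exact (Finset.card_le_univ _).trans (by simp)

theorem length_sep_le (i : Fin m) : (J.sep i).length ≤ (e i).card := by
  rw [sep, Finset.length_toList]
  exact Finset.card_le_card Finset.inter_subset_left

theorem depth_eq_zero_iff {i : Fin m} : J.depth i = 0 ↔ J.par i = none := by
  refine ⟨fun h => ?_, J.depth_root i⟩
  cases hp : J.par i with
  | none => rfl
  | some p => have := J.depth_child i p hp; omega

/-- Every vertex of the root occurs in a child of the root if it occurs in some hyperedge. -/
theorem exists_root_child {x : ℕ} (hx : x ∈ Z) {i : Fin m} (hi : x ∈ e i) :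
    ∃ c, J.par c = none ∧ x ∈ e c := by
  by_contra! hc
  -- If no child of the root contained `x`, being the root would be invariant along the edges
  -- between nodes containing `x`.
  have := J.running x (fun u => u = none) ?_ none (some i) hx hi rfl
  · simp at this
  · intro j hj _
    simp only [reduceCtorEq, false_iff]
    exact fun h => hc j h hj

theorem exists_depth_bound : ∃ N, ∀ i, J.depth i < N := by
  refine ⟨Finset.univ.sup J.depth + 1, fun i => ?_⟩
  exact Nat.lt_succ_of_le (Finset.le_sup (Finset.mem_univ i))

/-- Bottom-up induction. -/
theorem bottomUp {P : Fin m → Prop} (h : ∀ i, (∀ j, J.par j = some i → P j) → P i) (i : Fin m) :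
    P i := by
  obtain ⟨N, hN⟩ := J.exists_depth_bound
  -- Induction on the distance of the depth from its upper bound `N`.
  have : ∀ k i, N ≤ J.depth i + k → P i := by
    intro k
    induction k with
    | zero => intro i hi; have := hN i; omega
    | succ k ih =>
      intro i hi
      refine h i fun j hj => ih j ?_
      have := J.depth_child j i hj
      omega
  exact this N i (by omega)

/-- Top-down choice. -/
noncomputable def topDown {α : Fin m → Type*} {P : ∀ i, α i → Prop}
    {R : ∀ i j, α i → α j → Prop} (hroot : ∀ i, J.par i = none → ∃ a, P i a)
    (hkid : ∀ i p, J.par i = some p → ∀ a, P p a → ∃ b, P i b ∧ R p i a b) (i : Fin m) :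
    {a : α i // P i a} :=
  match h : J.par i with
  | none => ⟨(hroot i h).choose, (hroot i h).choose_spec⟩
  | some p =>
    have := J.depth_child i p h
    let a := topDown hroot hkid p
    ⟨(hkid i p h a.1 a.2).choose, (hkid i p h a.1 a.2).choose_spec.1⟩
termination_by J.depth i

/-- The subtype returned by `topDown` records only `P`; `R` is recovered by unfolding the recursion
once, since the value at a child was chosen from the value at its parent. -/
theorem exists_topDown {α : Fin m → Type*} {P : ∀ i, α i → Prop}
    {R : ∀ i j, α i → α j → Prop} (hroot : ∀ i, J.par i = none → ∃ a, P i a)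
    (hkid : ∀ i p, J.par i = some p → ∀ a, P p a → ∃ b, P i b ∧ R p i a b) :
    ∃ f : ∀ i, α i, (∀ i, P i (f i)) ∧ ∀ i p, J.par i = some p → R p i (f p) (f i) := by
  refine ⟨fun i => (J.topDown hroot hkid i).1, fun i => (J.topDown hroot hkid i).2, ?_⟩
  intro i p h
  have : (J.topDown hroot hkid i).1 = (hkid i p h _ (J.topDown hroot hkid p).2).choose := by
    rw [topDown]
    split
    · rename_i hq
      exact absurd (h.symm.trans hq) (by simp)
    · rename_i q hq
      obtain rfl : p = q := by simpa [h] using hq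
      rfl
  dsimp only
  rw [this]
  exact (hkid i p h _ (J.topDown hroot hkid p).2).choose_spec.2

/-- Unfolding the recursion `u i = w i * ∏ u j`, with the product over the children of `i`, from
the root; `r` is the equality or the order of a dioid. -/
theorem prod_unfold {W : Type*} [CommMonoid W] (r : W → W → Prop) (hr : ∀ a, r a a)
    (ht : ∀ a b c, r a b → r b c → r a c) (hm : ∀ a b c d, r a b → r c d → r (a * c) (b * d))
    (u w : Fin m → W) (h : ∀ i, r (u i) (w i * ((J.kids i).map u).prod)) :
    r (∏ i with J.par i = none, u i) (∏ i, w i) := by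
  have hprod : ∀ (s : Finset (Fin m)) (f g : Fin m → W), (∀ i ∈ s, r (f i) (g i)) →
      r (∏ i ∈ s, f i) (∏ i ∈ s, g i) := by
    intro s f g hs
    induction s using Finset.induction_on with
    | empty => exact hr _
    | insert a s ha ih =>
      rw [Finset.prod_insert ha, Finset.prod_insert ha]
      exact hm _ _ _ _ (hs a (by simp)) (ih fun i hi => hs i (by simp [hi]))
  -- Invariant of the descent: levels above `d` are already replaced by their `w`, while level `d`
  -- still carries `u`.
  have key : ∀ d, r (∏ i with J.par i = none, u i)
      ((∏ i with J.depth i < d, w i) * ∏ i with J.depth i = d, u i) := by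
    intro d
    induction d with
    | zero => simpa [J.depth_eq_zero_iff] using hr _
    | succ d ih =>
      refine ht _ _ _ ih ?_
      have e1 : (∏ i with J.depth i < d + 1, w i) =
          (∏ i with J.depth i < d, w i) * ∏ i with J.depth i = d, w i := by
        rw [← Finset.prod_union]
        · congr 1; ext i; simp; omega
        · rw [Finset.disjoint_filter]; intro i _ h; omega
      have e2 : (∏ i with J.depth i = d + 1, u i) =
          ∏ i with J.depth i = d, ((J.kids i).map u).prod := by
        simp only [kids, Finset.prod_map_toList]
        -- The nodes of level `d + 1` are the children of those of level `d`, and each has exactly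
        -- one parent.
        rw [Finset.prod_comm' (t' := Finset.univ.filter fun j => J.depth j = d + 1)
          (s' := fun j => Finset.univ.filter fun i => J.par j = some i)]
        · refine Finset.prod_congr rfl fun j hj => ?_
          cases hp : J.par j with
          | none => simp [J.depth_root j hp] at hj
          | some p => simp [Finset.filter_eq]
        · intro i j
          simp only [Finset.mem_filter, Finset.mem_univ, true_and]
          constructor
          · rintro ⟨h1, h2⟩
            exact ⟨h2, by rw [J.depth_child j i h2, h1]⟩
          · rintro ⟨h1, h2⟩
            have := J.depth_child j i h1
            exact ⟨by omega, h1⟩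
      rw [e1, e2, mul_assoc, ← Finset.prod_mul_distrib]
      exact hm _ _ _ _ (hr _) (hprod _ _ _ fun i _ => h i)
  obtain ⟨N, hN⟩ := J.exists_depth_bound
  have h1 : (Finset.univ.filter fun i => J.depth i < N) = Finset.univ := by
    ext i; simp [hN i]
  have h2 : (Finset.univ.filter fun i => J.depth i = N) = ∅ := by
    ext i; simp [(hN i).ne]
  have := key N
  rwa [h1, h2, Finset.prod_empty, mul_one] at this

end RootedJoinTree

/-! ### Messages -/

namespace CQ

variable {Z : Finset ℕ} (Q : CQ Z)

/-- A position of the variable `x` in atom `i`, if there is one. -/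
noncomputable def pos (i : Fin Q.numAtoms) (x : ℕ) : ℕ :=
  if h : ∃ c, Q.var i c = x then h.choose.val else 0

variable {Q}

theorem exists_var {i : Fin Q.numAtoms} {x : ℕ} (hx : x ∈ Q.atomVars i) : ∃ c, Q.var i c = x := by
  simpa [atomVars] using hx

theorem pos_lt {i : Fin Q.numAtoms} {x : ℕ} (hx : x ∈ Q.atomVars i) :
    Q.pos i x < Q.arity (Q.rel i) := by
  rw [pos, dif_pos (exists_var hx)]
  exact Fin.isLt _

theorem var_pos {i : Fin Q.numAtoms} {x : ℕ} (hx : x ∈ Q.atomVars i) :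
    Q.var i ⟨Q.pos i x, pos_lt hx⟩ = x := by
  have h := exists_var hx
  have : (⟨Q.pos i x, pos_lt hx⟩ : Fin _) = h.choose := by
    ext; simp [pos, dif_pos h]
  rw [this, h.choose_spec]

theorem var_mem (i : Fin Q.numAtoms) (c) : Q.var i c ∈ Q.atomVars i := by simp [atomVars]

theorem card_atomVars_le (i : Fin Q.numAtoms) : (Q.atomVars i).card ≤ Q.arity (Q.rel i) :=
  Finset.card_image_le.trans (by simp)

end CQ

section Messages

variable {Z : Finset ℕ} {A W : Type*} {Q : CQ Z} [Nonempty A]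

/-- The value of the variable `x` in tuple `t` of the relation of atom `i`. -/
noncomputable def tupleVal (D : Database Q A W) (i : Fin Q.numAtoms) (t : Fin (D (Q.rel i)).card)
    (x : ℕ) : A :=
  if h : x ∈ Q.atomVars i then (D (Q.rel i)).row t ⟨Q.pos i x, CQ.pos_lt h⟩
  else Classical.arbitrary A

/-- Positions of tuple `t` with the same variable carry the same value. -/
def Consistent (D : Database Q A W) (i : Fin Q.numAtoms) (t : Fin (D (Q.rel i)).card) : Prop :=
  ∀ c, (D (Q.rel i)).row t c = tupleVal D i t (Q.var i c)

theorem tupleVal_eq {D : Database Q A W} {ν : ℕ → A} {t : Choice Q D}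
    (h : ∀ i c, (D (Q.rel i)).row (t i) c = ν (Q.var i c)) {i : Fin Q.numAtoms} {x : ℕ}
    (hx : x ∈ Q.atomVars i) : tupleVal D i (t i) x = ν x := by
  rw [tupleVal, dif_pos hx, h, CQ.var_pos hx]

variable [SelectiveDioid W] (J : RootedJoinTree Q.atomVars Z) (D : Database Q A W)

/-- The part of tuple `t` of atom `i` that is relevant to the separator of `j`. -/
noncomputable def key (i : Fin Q.numAtoms) (t : Fin (D (Q.rel i)).card) (j : Fin Q.numAtoms) :
    List A := (J.sep j).map (tupleVal D i t)

open Classical in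
/-- The weight of tuple `t` of atom `i` combined with the messages `M` of the children of `i`. -/
noncomputable def contrib (M : Fin Q.numAtoms → List A → Option W) (i : Fin Q.numAtoms)
    (t : Fin (D (Q.rel i)).card) : Option W :=
  -- The test that all messages are present makes the default `1` of `getD` below immaterial.
  if Consistent D i t ∧ ∀ j ∈ J.kids i, (M j (key J D i t j)).isSome then
    some ((D (Q.rel i)).weight t *
      ((J.kids i).map fun j => (M j (key J D i t j)).getD 1).prod)
  else none

/-- The message of `i` consists of the minimal contributions of the tuples of `i`. -/
structure IsMessage (M : Fin Q.numAtoms → List A → Option W) (i : Fin Q.numAtoms) : Prop where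
  sound : ∀ κ w, M i κ = some w → ∃ t, key J D i t i = κ ∧ contrib J D M i t = some w
  complete : ∀ t w, contrib J D M i t = some w →
    ∃ w', M i (key J D i t i) = some w' ∧ Before w' w

theorem contrib_eq_some {M : Fin Q.numAtoms → List A → Option W} {i : Fin Q.numAtoms}
    {t : Fin (D (Q.rel i)).card} {w : W} :
    contrib J D M i t = some w ↔ Consistent D i t ∧
      (∀ j ∈ J.kids i, (M j (key J D i t j)).isSome) ∧
      (D (Q.rel i)).weight t *
        ((J.kids i).map fun j => (M j (key J D i t j)).getD 1).prod = w := by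
  unfold contrib
  split <;> simp_all

/-- The children of the root, enumerated. -/
noncomputable def rootChild (J : RootedJoinTree Q.atomVars Z) :
    Fin (Fintype.card {c // J.par c = none}) ≃ {c // J.par c = none} :=
  (Fintype.equivFin _).symm

/-- The full query whose atoms are the separators between the root and its children. -/
noncomputable def fullQuery : CQ Z where
  numRel := Fintype.card {c // J.par c = none}
  -- The arity may be `0`: such an atom records whether a part of the query without free variables
  -- is satisfiable, and its least weight.
  arity j := (J.sep (rootChild J j).1).length
  numAtoms := Fintype.card {c // J.par c = none}
  rel := id
  var j := (J.sep (rootChild J j).1).get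
  free_occurs x hx := by
    obtain ⟨i, c, h⟩ := Q.free_occurs x hx
    obtain ⟨d, hd, hxd⟩ := J.exists_root_child hx (h ▸ CQ.var_mem i c)
    have hs : x ∈ J.sep d := J.mem_sep.2 ⟨hxd, by simpa [hd] using hx⟩
    obtain ⟨k, hk⟩ := List.get_of_mem hs
    obtain ⟨j, hj⟩ := (rootChild J).surjective ⟨d, hd⟩
    have hj' : (rootChild J j).1 = d := by rw [hj]
    subst hj'
    exact ⟨j, k, hk⟩

theorem fullQuery_isFull : (fullQuery J).IsFull := by
  intro j x hx
  obtain ⟨c, hc⟩ := CQ.exists_var hx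
  have : x ∈ J.sep (rootChild J j).1 := hc ▸ List.get_mem _ c
  simpa [(rootChild J j).2] using (J.mem_sep.1 this).2

theorem fullQuery_sizeAtMost {s : ℕ} (h : Q.SizeAtMost s) : (fullQuery J).SizeAtMost s := by
  constructor
  · exact (Fintype.card_subtype_le fun c => J.par c = none).trans
      ((Fintype.card_fin _).trans_le h.1)
  · intro j
    exact (J.length_sep_le _).trans ((CQ.card_atomVars_le _).trans (h.2 _))

/-! ### Equivalence of the two ranked enumerations -/

variable {J D}

/-- The relations of `D'` are the messages of the children of the root. -/
structure Stores (D' : Database (fullQuery J) A W) (M : Fin Q.numAtoms → List A → Option W) :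
    Prop where
  sound : ∀ j r, M (rootChild J j).1 (List.ofFn ((D' j).row r)) = some ((D' j).weight r)
  complete : ∀ j κ w, M (rootChild J j).1 κ = some w →
    ∃ r, List.ofFn ((D' j).row r) = κ ∧ (D' j).weight r = w

variable {M : Fin Q.numAtoms → List A → Option W} {D' : Database (fullQuery J) A W}

theorem prod_rootChild (f : Fin Q.numAtoms → W) :
    ∏ j, f (rootChild J j).1 = ∏ i with J.par i = none, f i := by
  rw [Equiv.prod_comp (rootChild J) (fun c => f c.1)]
  exact (Finset.prod_subtype _ (by simp) _).symm

/-- Bottom-up, the message of each atom is defined at the values of the witness, and completeness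
bounds it by the weight of the chosen tuple times the messages of the children. `prod_unfold` with
`Before` multiplies these bounds. -/
theorem exists_full_witness (hM : ∀ i, IsMessage J D M i) (hD' : Stores D' M) {q : Z → A}
    {t : Choice Q D} (ht : IsWitness Q D q t) :
    ∃ t' : Choice (fullQuery J) D', IsWitness (fullQuery J) D' q t' ∧
      Before (witnessWeight (fullQuery J) D' t') (witnessWeight Q D t) := by
  obtain ⟨ν, hν, hq⟩ := ht
  have hcons : ∀ i, Consistent D i (t i) := by
    intro i c
    rw [hν, tupleVal_eq hν (CQ.var_mem i c)]
  have hkey : ∀ i, key J D i (t i) i = (J.sep i).map ν := fun i =>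
    List.map_congr_left fun x hx => tupleVal_eq hν (J.mem_sep.1 hx).1
  have hkid : ∀ i j, J.par j = some i → key J D i (t i) j = (J.sep j).map ν := fun i j h =>
    List.map_congr_left fun x hx => tupleVal_eq hν (by simpa [h] using (J.mem_sep.1 hx).2)
  have hex : ∀ i, ∃ w, M i ((J.sep i).map ν) = some w := by
    refine J.bottomUp fun i ih => ?_
    obtain ⟨w', hw', -⟩ := (hM i).complete (t i) _ ((contrib_eq_some J D).2 ⟨hcons i, fun j hj => by
      rw [hkid i j (J.mem_kids.1 hj)]
      obtain ⟨w, hw⟩ := ih j (J.mem_kids.1 hj)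
      simp [hw], rfl⟩)
    exact ⟨w', hkey i ▸ hw'⟩
  choose u hu using hex
  have hstep : ∀ i, Before (u i) ((D (Q.rel i)).weight (t i) * ((J.kids i).map u).prod) := by
    intro i
    obtain ⟨w', hw', hb⟩ := (hM i).complete (t i) _
      ((contrib_eq_some J D).2 ⟨hcons i, fun j hj => by
      rw [hkid i j (J.mem_kids.1 hj), hu j]; rfl, rfl⟩)
    rw [hkey i, hu i] at hw'
    cases hw'
    convert hb using 3
    refine List.map_congr_left fun j hj => ?_
    rw [hkid i j (J.mem_kids.1 hj), hu j]; rfl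
  have hprod := J.prod_unfold Before Before.refl (fun _ _ _ => Before.trans)
    (fun _ _ _ _ => Before.mul) u _ hstep
  choose r hr hw using fun j => hD'.complete j _ _ (hu (rootChild J j).1)
  refine ⟨r, ⟨ν, ?_, hq⟩, ?_⟩
  · intro j c
    have hc : c.1 < (J.sep (rootChild J j).1).length := c.2
    have h1 : (List.ofFn ((D' j).row (r j)))[c.1]'(by rw [hr j]; simpa using hc) =
        ((J.sep (rootChild J j).1).map ν)[c.1]'(by simpa using hc) := by
      congr 1; exact hr j
    simp only [List.getElem_ofFn, List.getElem_map] at h1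
    exact h1
  · have : witnessWeight (fullQuery J) D' r = ∏ i with J.par i = none, u i := by
      rw [← prod_rootChild u]
      exact Finset.prod_congr rfl fun j _ => hw j
    rw [this]
    exact hprod

/-- Soundness provides, for each message value in use, one tuple that attains it exactly. Passing to
the children fixes the values to attain next, and `prod_unfold` with equality yields the weight. -/
theorem exists_witness (hM : ∀ i, IsMessage J D M i) (hD' : Stores D' M) {q : Z → A}
    {t' : Choice (fullQuery J) D'} (ht' : IsWitness (fullQuery J) D' q t') :
    ∃ t : Choice Q D, IsWitness Q D q t ∧
      witnessWeight Q D t = witnessWeight (fullQuery J) D' t' := by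
  obtain ⟨ν, hν, hq⟩ := ht'
  have hrow : ∀ j, List.ofFn ((D' j).row (t' j)) = (J.sep (rootChild J j).1).map ν := by
    intro j
    apply List.ext_get
    · simp [fullQuery]
    · intro n h1 h2
      have h3 : n < (J.sep (rootChild J j).1).length := by simpa using h2
      simp only [List.get_eq_getElem, List.getElem_ofFn, List.getElem_map]
      exact hν j ⟨n, h3⟩
  -- `exists_topDown` needs one predicate for all nodes, so the condition on children of the root is
  -- guarded by `J.par i = none`.
  have hroot : ∀ i, J.par i = none → ∃ a, (contrib J D M i a).isSome ∧ (J.par i = none →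
      key J D i a i = (J.sep i).map ν ∧ contrib J D M i a = M i ((J.sep i).map ν)) := by
    intro i hi
    obtain ⟨j, hj⟩ := (rootChild J).surjective ⟨i, hi⟩
    have hj' : (rootChild J j).1 = i := by rw [hj]
    have h := hD'.sound j (t' j)
    rw [hrow j, hj'] at h
    obtain ⟨a, ha, hc⟩ := (hM i).sound _ _ h
    exact ⟨a, by simp [hc], fun _ => ⟨ha, hc.trans h.symm⟩⟩
  have hkid : ∀ i p, J.par i = some p → ∀ a, ((contrib J D M p a).isSome ∧ (J.par p = none →
      key J D p a p = (J.sep p).map ν ∧ contrib J D M p a = M p ((J.sep p).map ν))) →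
      ∃ b, ((contrib J D M i b).isSome ∧ (J.par i = none →
      key J D i b i = (J.sep i).map ν ∧ contrib J D M i b = M i ((J.sep i).map ν))) ∧
      (key J D i b i = key J D p a i ∧ contrib J D M i b = M i (key J D p a i)) := by
    rintro i p hp a ⟨ha, -⟩
    obtain ⟨w, hw⟩ := Option.isSome_iff_exists.1 ha
    obtain ⟨-, hs, -⟩ := (contrib_eq_some J D).1 hw
    obtain ⟨w', hw'⟩ := Option.isSome_iff_exists.1 (hs i (J.mem_kids.2 hp))
    obtain ⟨b, hb, hc⟩ := (hM i).sound _ _ hw'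
    exact ⟨b, ⟨by simp [hc], fun h => by simp [hp] at h⟩, hb, hc.trans hw'.symm⟩
  obtain ⟨t, ht, hpar⟩ := J.exists_topDown
    (R := fun p i a b => key J D i b i = key J D p a i ∧ contrib J D M i b = M i (key J D p a i))
    hroot hkid
  choose u hu using fun i => Option.isSome_iff_exists.1 (ht i).1
  have hc := fun i => (contrib_eq_some J D).1 (hu i)
  -- the value of a variable at a node of the join tree
  let f : Option (Fin Q.numAtoms) → ℕ → A := fun o => o.elim ν fun i => tupleVal D i (t i)
  have hf : ∀ i, ∀ x ∈ J.sep i, f (some i) x = f (J.par i) x := by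
    intro i
    rw [← List.map_inj_left]
    cases hp : J.par i with
    | none => exact ((ht i).2 hp).1
    | some p => exact (hpar i p hp).1
  -- Chosen tuples agree across each edge by `hf`; running intersection extends this to any two
  -- nodes containing `x`.
  have hagree : ∀ x u v, x ∈ u.elim Z Q.atomVars → x ∈ v.elim Z Q.atomVars → f u x = f v x := by
    intro x u v hu hv
    refine (J.running x (fun o => f u x = f o x) (fun i h1 h2 => ?_) u v hu hv rfl)
    rw [hf i x (J.mem_sep.2 ⟨h1, h2⟩)]
  classical
  -- By `hagree` any node containing `x` may supply its value; variables in no node keep an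
  -- arbitrary value.
  let μ : ℕ → A := fun x => if h : ∃ o : Option (Fin Q.numAtoms), x ∈ o.elim Z Q.atomVars
    then f h.choose x else ν x
  have hμ : ∀ x o, x ∈ o.elim Z Q.atomVars → μ x = f o x := by
    intro x o ho
    have h : ∃ o : Option (Fin Q.numAtoms), x ∈ o.elim Z Q.atomVars := ⟨o, ho⟩
    simp only [μ, dif_pos h]
    exact hagree x _ _ h.choose_spec ho
  refine ⟨t, ⟨μ, fun i c => ?_, fun x => ?_⟩, ?_⟩
  · rw [hμ _ (some i) (CQ.var_mem i c)]
    exact (hc i).1 c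
  · rw [hμ _ none x.2]
    exact hq x
  · have hprod := J.prod_unfold Eq (fun _ => rfl) (fun _ _ _ => Eq.trans)
      (fun _ _ _ _ h1 h2 => by rw [h1, h2]) u (fun i => (D (Q.rel i)).weight (t i)) (fun i => by
        rw [← (hc i).2.2]
        congr 2
        refine List.map_congr_left fun j hj => ?_
        rw [← (hpar j i (J.mem_kids.1 hj)).2, hu j]; rfl)
    refine hprod.symm.trans ?_
    rw [← prod_rootChild u]
    refine Finset.prod_congr rfl fun j _ => ?_
    have h := hD'.sound j (t' j)
    rw [hrow j, ← ((ht _).2 (rootChild J j).2).2, hu] at h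
    exact Option.some.inj h

theorem isRankedEnumeration_iff (hM : ∀ i, IsMessage J D M i) (hD' : Stores D' M)
    (L : List ((Z → A) × W)) :
    IsRankedEnumeration Q D L ↔ IsRankedEnumeration (fullQuery J) D' L := by
  have hans : answers Q D = answers (fullQuery J) D' := by
    ext q
    constructor
    · rintro ⟨t, ht⟩
      obtain ⟨t', h, -⟩ := exists_full_witness hM hD' ht
      exact ⟨t', h⟩
    · rintro ⟨t, ht⟩
      obtain ⟨t', h, -⟩ := exists_witness hM hD' ht
      exact ⟨t', h⟩
  have hmin : ∀ q w, IsMinWeight Q D q w ↔ IsMinWeight (fullQuery J) D' q w := by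
    intro q w
    constructor
    · rintro ⟨⟨t, ht, rfl⟩, hle⟩
      refine ⟨?_, fun t' ht' => ?_⟩
      -- The full witness is at most as heavy as `t`; pulled back to `Q`, it cannot be lighter than
      -- the minimum.
      · obtain ⟨t', ht', hb⟩ := exists_full_witness hM hD' ht
        obtain ⟨t₂, ht₂, he⟩ := exists_witness hM hD' ht'
        exact ⟨t', ht', hb.antisymm (he ▸ hle t₂ ht₂)⟩
      · obtain ⟨t₂, ht₂, he⟩ := exists_witness hM hD' ht'
        exact he ▸ hle t₂ ht₂
    · rintro ⟨⟨t', ht', rfl⟩, hle⟩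
      refine ⟨?_, fun t ht => ?_⟩
      · obtain ⟨t, ht, he⟩ := exists_witness hM hD' ht'
        exact ⟨t, ht, he⟩
      · obtain ⟨t₂, ht₂, hb⟩ := exists_full_witness hM hD' ht
        exact (hle t₂ ht₂).trans hb
  constructor
  · rintro ⟨h1, h2, h3, h4⟩
    exact ⟨h1, hans ▸ h2, fun p hp => (hmin _ _).1 (h3 p hp), h4⟩
  · rintro ⟨h1, h2, h3, h4⟩
    exact ⟨h1, hans ▸ h2, fun p hp => (hmin _ _).2 (h3 p hp), h4⟩

end Messages

/-! ### Correctness rules for programs -/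

section Rules

variable {Z : Finset ℕ} {A W : Type*} {Q : CQ Z} [SelectiveDioid W] (D : Database Q A W)

/-- Started in `σ`, the program halts within `B` steps in a state with property `Φ`. -/
def Reach (p : Prog) (σ : State A W) (B : ℕ) (Φ : State A W → Prop) : Prop :=
  ∃ τ t, Exec D p σ τ t ∧ t ≤ B ∧ Φ τ

/-- Straight-line code. -/
def ops : List Instr → Prog
  | [] => .skip
  | i :: l => .seq (.op i) (ops l)

/-- Consecutive execution of a list of programs. -/
def seqList : List Prog → Prog
  | [] => .skip
  | p :: l => .seq p (seqList l)

/-- Execute the body for each tuple of input relation `j`; the number of the tuple is in `N[3]`, the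
number of tuples in `N[4]`, and `N[1] = 1`. -/
def forTuples (j : ℕ) (body : Prog) : Prog :=
  .seq (ops [.const 3 0, .inCard 4 j])
    (.loop (.ltNum 3 4) (.seq body (.op (.add 3 3 1))))

variable {D} {p q : Prog} {σ : State A W} {B B₁ B₂ : ℕ} {Φ Ψ : State A W → Prop}

theorem Reach.mono (h : Reach D p σ B₁ Φ) (hB : B₁ ≤ B) (hΦ : ∀ τ, Φ τ → Ψ τ) :
    Reach D p σ B Ψ := by
  obtain ⟨τ, t, he, ht, hτ⟩ := h
  exact ⟨τ, t, he, ht.trans hB, hΦ τ hτ⟩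

theorem Reach.skip (h : Φ σ) : Reach D .skip σ 1 Φ := ⟨σ, 1, .skip σ, le_rfl, h⟩

theorem Reach.op (i : Instr) (h : Φ (i.run D σ)) : Reach D (.op i) σ i.cost Φ :=
  ⟨_, _, .op i σ, le_rfl, h⟩

theorem Reach.seq (h : Reach D p σ B₁ fun τ => Reach D q τ B₂ Φ) :
    Reach D (.seq p q) σ (B₁ + B₂) Φ := by
  obtain ⟨τ, t, he, ht, ρ, t', he', ht', hρ⟩ := h
  exact ⟨ρ, t + t', .seq he he', by omega, hρ⟩

theorem Reach.ite {b : Test} (h₁ : b.Holds σ → Reach D p σ B Φ)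
    (h₂ : ¬ b.Holds σ → Reach D q σ B Φ) : Reach D (.ite b p q) σ (B + 1) Φ := by
  by_cases hb : b.Holds σ
  · obtain ⟨τ, t, he, ht, hτ⟩ := h₁ hb
    exact ⟨τ, t + 1, .ite_true hb he, by omega, hτ⟩
  · obtain ⟨τ, t, he, ht, hτ⟩ := h₂ hb
    exact ⟨τ, t + 1, .ite_false hb he, by omega, hτ⟩

theorem Reach.ops {l : List Instr} (h : Φ (l.foldl (fun τ i => i.run D τ) σ)) :
    Reach D (ops l) σ ((l.map Instr.cost).sum + 1) Φ := by
  induction l generalizing σ with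
  | nil => exact .skip h
  | cons i l ih =>
    refine (Reach.seq (Reach.op i (ih h))).mono ?_ fun _ => id
    simp [add_assoc]

theorem Reach.seqList {α : Type*} (l : List α) (f : α → Prog) (Inv : List α → State A W → Prop)
    (h : ∀ pre x suf, l = pre ++ x :: suf → ∀ τ, Inv pre τ → Reach D (f x) τ B (Inv (pre ++ [x])))
    (h₀ : Inv [] σ) : Reach D (seqList (l.map f)) σ (l.length * B + 1) (Inv l) := by
  have key : ∀ suf pre σ, l = pre ++ suf → Inv pre σ →
      Reach D (RankedCQ.seqList (suf.map f)) σ (suf.length * B + 1) (Inv l) := by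
    intro suf
    induction suf with
    | nil =>
      intro pre σ hl hi
      rw [List.append_nil] at hl
      exact (Reach.skip (D := D) (hl ▸ hi)).mono (by simp) fun _ => id
    | cons x suf ih =>
      intro pre σ hl hi
      refine (Reach.seq ((h pre x suf hl σ hi).mono le_rfl fun τ hτ =>
        ih (pre ++ [x]) τ (by simp [hl]) hτ)).mono ?_ fun _ => id
      simp only [List.length_cons]
      linarith [add_mul suf.length 1 B]
  exact key l [] σ rfl h₀

/-- Each round pays two steps beyond the body, for the increment and the test. The remaining `4` are
the initial block, of cost `3`, and the final failing test. -/
theorem Reach.forTuples {j : Fin Q.numRel} {body : Prog} (Inv : ℕ → State A W → Prop)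
    (hreg : ∀ k τ, Inv k τ → τ.num 1 = 1 ∧ τ.num 3 = k ∧ τ.num 4 = (D j).card)
    (h₀ : Inv 0
      { σ with num := Function.update (Function.update σ.num 3 0) 4 (D j).card })
    (hstep : ∀ k < (D j).card, ∀ τ, Inv k τ → Reach D body τ B fun τ' =>
      τ'.num 1 = 1 ∧ τ'.num 3 = k ∧ Inv (k + 1)
        { τ' with num := Function.update τ'.num 3 (k + 1) }) :
    Reach D (forTuples j body) σ ((D j).card * (B + 2) + 4) (Inv (D j).card) := by
  have key : ∀ r k τ, k + r = (D j).card → Inv k τ →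
      Reach D (.loop (.ltNum 3 4) (.seq body (.op (.add 3 3 1)))) τ (r * (B + 2) + 1)
        (Inv (D j).card) := by
    intro r
    induction r with
    | zero =>
      intro k τ hk hi
      obtain ⟨h1, h3, h4⟩ := hreg k τ hi
      refine ⟨τ, 1, .loop_false ?_, by omega, ?_⟩
      · simp only [Test.Holds]; omega
      · rwa [← hk]
    | succ r ih =>
      intro k τ hk hi
      obtain ⟨h1, h3, h4⟩ := hreg k τ hi
      obtain ⟨τ', t, he, ht, h1', h3', hi'⟩ := hstep k (by omega) τ hi
      obtain ⟨ρ, t', he', ht', hρ⟩ := ih (k + 1) _ (by omega) hi'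
      refine ⟨ρ, (t + Instr.cost (.add 3 3 1)) + t' + 1,
        .loop_true ?_ (.seq he ?_) he', ?_, hρ⟩
      · simp only [Test.Holds]; omega
      · convert Exec.op (D := D) (.add 3 3 1) τ' using 1
        simp [Instr.run, h1', h3']
      · simp only [Instr.cost]
        linarith [add_mul r 1 (B + 2)]
  have hinit := key (D j).card 0 _ (by omega) h₀
  refine (Reach.seq (B₁ := 3) (B₂ := (D j).card * (B + 2) + 1) (Reach.ops ?_)).mono
    (by omega) fun _ => id
  simpa [Instr.run] using hinit

end Rules

/-! ### Tries -/

section Tries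

variable {A : Type*}

/-- The node of a trie that is reached from node `a` along the path `l`; it is `0` if there is no
such node. -/
def walk (tab : ℕ → A → ℕ) (a : ℕ) (l : List A) : ℕ := l.foldl tab a

/-- The lookup table is a family of tries with roots below `lo` whose other nodes lie in
`[lo, fresh)`. -/
structure IsTrie (tab : ℕ → A → ℕ) (lo fresh : ℕ) : Prop where
  pos : 0 < lo
  le : lo ≤ fresh
  -- A walk that has left the trie stays at `0`, so lookups need no test along the way.
  zero : ∀ v, tab 0 v = 0
  lt : ∀ a v, tab a v < fresh
  big : ∀ a v, fresh ≤ a → tab a v = 0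
  ge : ∀ a v, tab a v ≠ 0 → lo ≤ tab a v
  inj : ∀ a b v u, tab a v = tab b u → tab a v ≠ 0 → a = b ∧ v = u

variable {tab : ℕ → A → ℕ} {lo fresh r r' : ℕ} {l l' : List A}

@[simp] theorem walk_nil (tab : ℕ → A → ℕ) (a : ℕ) : walk tab a [] = a := rfl

theorem walk_concat (tab : ℕ → A → ℕ) (a : ℕ) (l : List A) (v : A) :
    walk tab a (l ++ [v]) = tab (walk tab a l) v := by simp [walk]

namespace IsTrie

theorem init (h : 0 < lo) : IsTrie (fun (_ : ℕ) (_ : A) => 0) lo lo :=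
  ⟨h, le_rfl, by simp, fun _ _ => h, by simp, by simp, by simp⟩

theorem walk_lt (h : IsTrie tab lo fresh) (hr : r < lo) : walk tab r l < fresh := by
  induction l using List.reverseRecOn with
  | nil => exact hr.trans_le h.le
  | append_singleton l v _ => rw [walk_concat]; exact h.lt _ _

theorem walk_ge (h : IsTrie tab lo fresh) (hl : l ≠ []) (hw : walk tab r l ≠ 0) :
    lo ≤ walk tab r l := by
  induction l using List.reverseRecOn with
  | nil => exact absurd rfl hl
  | append_singleton l v _ => rw [walk_concat] at hw ⊢; exact h.ge _ _ hw

/-- Distinct keys, or keys of distinct atoms, end at distinct nodes, so their weights and marks do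
not interfere. Edges can be traced back by `inj`, and the trace cannot pass a root because roots lie
below `lo` and all other nodes do not. -/
theorem walk_inj (h : IsTrie tab lo fresh) (hr : r < lo) (hr' : r' < lo)
    (he : walk tab r l = walk tab r' l') (hw : walk tab r l ≠ 0) : r = r' ∧ l = l' := by
  induction l using List.reverseRecOn generalizing l' with
  | nil =>
    rcases List.eq_nil_or_concat l' with rfl | ⟨l', v, rfl⟩
    · exact ⟨he, rfl⟩
    · have := h.walk_ge (by simp) (he ▸ hw)
      rw [← he, walk_nil] at this
      omega
  | append_singleton l u ih =>
    rcases List.eq_nil_or_concat l' with rfl | ⟨l', v, rfl⟩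
    · have := h.walk_ge (by simp) hw
      rw [he, walk_nil] at this
      omega
    · rw [walk_concat] at he hw
      rw [List.concat_eq_append, walk_concat] at he
      obtain ⟨h1, rfl⟩ := h.inj _ _ _ _ he hw
      have h0 : walk tab r l ≠ 0 := by
        intro h0; rw [h0, h.zero] at hw; exact hw rfl
      obtain ⟨rfl, rfl⟩ := ih h1 h0
      exact ⟨rfl, by simp⟩

variable {v : A}

open Classical in
/-- Adding the edge labelled `v` below the node with path `l`. -/
theorem extend (h : IsTrie tab lo fresh) (hr : r < lo) (hw : walk tab r l ≠ 0)
    (hv : tab (walk tab r l) v = 0) :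
    let tab' := Function.update tab (walk tab r l) (Function.update (tab (walk tab r l)) v fresh)
    IsTrie tab' lo (fresh + 1) ∧ walk tab' r (l ++ [v]) = fresh ∧
      ∀ r' l', r' < lo → ¬ (r' = r ∧ l' = l ++ [v]) → walk tab' r' l' = walk tab r' l' := by
  intro tab'
  have hlt : walk tab r l < fresh := h.walk_lt hr
  have htab : ∀ a u, tab' a u = if a = walk tab r l ∧ u = v then fresh else tab a u := by
    intro a u
    by_cases ha : a = walk tab r l
    · subst ha
      by_cases hu : u = v <;> simp [tab', hu]
    · simp [tab', ha]
  have hfresh : 0 < fresh := h.pos.trans_le h.le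
  have htrie : IsTrie tab' lo (fresh + 1) := by
    refine ⟨h.pos, h.le.trans (Nat.le_succ _), fun u => ?_, fun a u => ?_, fun a u ha => ?_,
      fun a u => ?_, fun a b u w => ?_⟩
    · rw [htab, if_neg (fun hh => hw hh.1.symm), h.zero]
    · rw [htab]; have := h.lt a u; split <;> omega
    · rw [htab, if_neg (fun hh => by omega), h.big a u (by omega)]
    · rw [htab]
      split
      · exact fun _ => h.le
      · exact h.ge a u
    · rw [htab, htab]
      have h1 := h.lt a u
      have h2 := h.lt b w
      split <;> split
      · rename_i h3 h4
        exact fun _ _ => ⟨h3.1.trans h4.1.symm, h3.2.trans h4.2.symm⟩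
      · omega
      · omega
      · exact h.inj a b u w
  have hmain : ∀ l' r', r' < lo → walk tab' r' l' =
      if r' = r ∧ l' = l ++ [v] then fresh else walk tab r' l' := by
    intro l'
    induction l' using List.reverseRecOn with
    | nil => intro r' _; simp
    | append_singleton l' u ih =>
      intro r' hr'
      rw [walk_concat, ih r' hr']
      by_cases hc : r' = r ∧ l' = l ++ [v]
      · obtain ⟨rfl, rfl⟩ := hc
        -- The new node has no outgoing edges, so longer paths through it are as absent as before.
        rw [if_pos ⟨rfl, rfl⟩, if_neg (by simp), htab, if_neg (fun hh => by omega),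
          h.big _ _ le_rfl, walk_concat, walk_concat, hv, h.zero]
      · rw [if_neg hc, htab, walk_concat]
        by_cases hd : walk tab r' l' = walk tab r l ∧ u = v
        · obtain ⟨hd, rfl⟩ := hd
          obtain ⟨rfl, rfl⟩ := h.walk_inj hr' hr hd (hd ▸ hw)
          simp
        · rw [if_neg hd, if_neg]
          rintro ⟨rfl, he⟩
          obtain ⟨rfl, he⟩ := List.append_inj' he rfl
          exact hd ⟨rfl, by simpa using he⟩
  refine ⟨htrie, ?_, fun r' l' hr' hne => ?_⟩
  · rw [hmain _ _ hr, if_pos ⟨rfl, rfl⟩]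
  · rw [hmain _ _ hr', if_neg hne]

end IsTrie

end Tries

/-! ### The program for one atom

Registers: `N[0], N[1], N[2]` hold the constants `0, 1, 2`; `N[3], N[4]` control the loop over the
tuples; `N[5]` is the current node of a trie and `N[6]` the next one; `N[7]` is a flag; `N[8]` is the
least unused node. The root of the trie of atom `i` is `10 + i`. The message of `i` at `κ` is stored
in `X` at the node with path `a :: κ`, where `a = V[0]` is never changed. `V[1]`, `V[2]` and `X[0]`
are temporary. -/

section Code

variable {Z : Finset ℕ} {Q : CQ Z} (J : RootedJoinTree Q.atomVars Z)

/-- Go to the node of the trie of `j` for the current tuple of atom `i`. -/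
noncomputable def lookup (i j : Fin Q.numAtoms) : Prog :=
  -- The first edge, labelled `V[0]`, separates presence from absence when the key is empty: the
  -- root itself is never `0`.
  .seq (ops [.const 5 (10 + j), .get 5 5 0])
    (seqList ((J.sep j).map fun x => ops [.inVal 1 (Q.rel i) 3 (Q.pos i x), .get 5 5 1]))

/-- Go to the child of the current node for the value at address `N[b]`; create it if necessary. -/
def descend (b : ℕ) : Prog :=
  .seq (ops [.get 6 5 b])
    (.seq (.ite (.eqNum 6 0) (ops [.put 5 b 8, .get 6 5 b, .add 8 8 1]) .skip)
      (ops [.add 5 6 0]))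

/-- Go to the node of the trie of `i` for the current tuple of `i`; create it if necessary. -/
noncomputable def insertKey (i : Fin Q.numAtoms) : Prog :=
  .seq (ops [.const 5 (10 + i)])
    (.seq (descend 0)
      (seqList ((J.sep i).map fun x =>
        .seq (ops [.inVal 1 (Q.rel i) 3 (Q.pos i x)]) (descend 1))))

/-- Clear the flag if the current tuple of atom `i` is not consistent. -/
noncomputable def checkConsistent (i : Fin Q.numAtoms) : Prog :=
  seqList ((List.finRange (Q.arity (Q.rel i))).map fun c =>
    .seq (ops [.inVal 1 (Q.rel i) 3 c.val, .inVal 2 (Q.rel i) 3 (Q.pos i (Q.var i c))])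
      (.ite (.eqVal 1 2) .skip (ops [.const 7 0])))

/-- Multiply `X[0]` with the messages of the children, and clear the flag if one of them is
missing. -/
noncomputable def collect (i : Fin Q.numAtoms) : Prog :=
  seqList ((J.kids i).map fun j =>
    -- If the lookup fails, `N[5] = 0` and the product reads `X[0]` itself; the result is discarded
    -- because the flag is cleared.
    .seq (lookup J i j) (.seq (.ite (.eqNum 5 0) (ops [.const 7 0]) .skip) (ops [.mulWt 0 0 5])))

/-- Process one tuple of atom `i`. -/
noncomputable def processTuple (i : Fin Q.numAtoms) : Prog :=
  .seq (ops [.const 7 1, .inWt 0 (Q.rel i) 3])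
    (.seq (checkConsistent i)
      (.seq (collect J i)
        -- New and old keys are treated alike: an unused node has weight `0`, which is neutral for
        -- `⊕`.
        (.ite (.eqNum 7 1) (.seq (insertKey J i) (ops [.addWt 5 5 0])) .skip)))

end Code

/-! ### What a program fragment leaves unchanged -/

section Frames

variable {A W : Type*}

/-- Only temporary data and the registers in `S` differ. -/
structure Frame (S : Set ℕ) (σ τ : State A W) : Prop where
  tab : τ.tab = σ.tab
  out : τ.out = σ.out
  num : ∀ r ∉ S, τ.num r = σ.num r
  val : τ.val 0 = σ.val 0
  wt : ∀ L ≠ 0, τ.wt L = σ.wt L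

theorem Frame.refl (S : Set ℕ) (σ : State A W) : Frame S σ σ :=
  ⟨rfl, rfl, fun _ _ => rfl, rfl, fun _ _ => rfl⟩

theorem Frame.trans {S : Set ℕ} {σ τ ρ : State A W} (h₁ : Frame S σ τ) (h₂ : Frame S τ ρ) :
    Frame S σ ρ :=
  ⟨h₂.tab.trans h₁.tab, h₂.out.trans h₁.out, fun r hr => (h₂.num r hr).trans (h₁.num r hr),
    h₂.val.trans h₁.val, fun L hL => (h₂.wt L hL).trans (h₁.wt L hL)⟩

theorem Frame.mono {S S' : Set ℕ} {σ τ : State A W} (h : Frame S σ τ) (hS : S ⊆ S') :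
    Frame S' σ τ :=
  ⟨h.tab, h.out, fun r hr => h.num r fun hh => hr (hS hh), h.val, h.wt⟩

/-- The constant registers, and the number of the current tuple. -/
structure Ready (σ : State A W) (k : ℕ) : Prop where
  zero : σ.num 0 = 0
  one : σ.num 1 = 1
  two : σ.num 2 = 2
  idx : σ.num 3 = k

theorem Ready.frame {S : Set ℕ} {σ τ : State A W} {k : ℕ} (h : Ready σ k) (hf : Frame S σ τ)
    (hS : ∀ r ∈ S, 4 < r) : Ready τ k := by
  have : ∀ r ≤ 4, τ.num r = σ.num r := fun r hr => hf.num r fun h => by have := hS r h; omega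
  exact ⟨(this 0 (by omega)).trans h.zero, (this 1 (by omega)).trans h.one,
    (this 2 (by omega)).trans h.two, (this 3 (by omega)).trans h.idx⟩

end Frames

/-! ### Reading the tries and computing the contribution of a tuple -/

section Correctness

variable {Z : Finset ℕ} {A W : Type*} {Q : CQ Z} [SelectiveDioid W] {D : Database Q A W}

theorem run_inVal {σ : State A W} {j : Fin Q.numRel} {a : ℕ} {k : Fin (D j).card}
    (hk : σ.num a = k) (r : ℕ) (c : Fin (Q.arity j)) :
    (Instr.inVal r j a c).run D σ =
      { σ with val := Function.update σ.val (σ.num r) ((D j).row k c) } := by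
  have h : σ.num a < (D j).card := hk ▸ k.2
  have : (⟨σ.num a, h⟩ : Fin _) = k := Fin.ext hk
  simp [Instr.run, h, this]

theorem run_inWt {σ : State A W} {j : Fin Q.numRel} {a : ℕ} {k : Fin (D j).card}
    (hk : σ.num a = k) (r : ℕ) :
    (Instr.inWt r j a).run D σ =
      { σ with wt := Function.update σ.wt (σ.num r) ((D j).weight k) } := by
  have h : σ.num a < (D j).card := hk ▸ k.2
  have : (⟨σ.num a, h⟩ : Fin _) = k := Fin.ext hk
  simp [Instr.run, h, this]

variable [Nonempty A] {J : RootedJoinTree Q.atomVars Z}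

theorem run_inVal_pos {σ : State A W} {i : Fin Q.numAtoms} {a : ℕ}
    {t : Fin (D (Q.rel i)).card} (hk : σ.num a = t) (r : ℕ) {x : ℕ} (hx : x ∈ Q.atomVars i) :
    (Instr.inVal r (Q.rel i) a (Q.pos i x)).run D σ =
      { σ with val := Function.update σ.val (σ.num r) (tupleVal D i t x) } := by
  rw [tupleVal, dif_pos hx, ← run_inVal hk r ⟨Q.pos i x, CQ.pos_lt hx⟩]

variable {σ : State A W} {i j : Fin Q.numAtoms} {t : Fin (D (Q.rel i)).card}

theorem reach_lookup (hσ : Ready σ t) (hj : ∀ x ∈ J.sep j, x ∈ Q.atomVars i) :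
    Reach D (lookup J i j) σ ((J.sep j).length * 3 + 4) fun τ =>
      Frame {5} σ τ ∧ τ.wt 0 = σ.wt 0 ∧
        τ.num 5 = walk σ.tab (10 + j) (σ.val 0 :: key J D i t j) := by
  refine (Reach.seq (B₁ := 3) (B₂ := (J.sep j).length * 3 + 1) (Reach.ops ?_)).mono (by omega)
    fun _ => id
  refine (Reach.seqList (J.sep j) _ (fun pre τ => Frame {5} σ τ ∧ τ.wt 0 = σ.wt 0 ∧
        τ.num 5 = walk σ.tab (10 + j) (σ.val 0 :: pre.map (tupleVal D i t))) ?_ ?_)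
  · rintro pre x suf hl τ ⟨hf, hw, hc⟩
    have hr := hσ.frame hf (by simp)
    refine Reach.ops ?_
    simp only [List.foldl_cons, List.foldl_nil]
    rw [run_inVal_pos hr.idx 1 (hj x (by simp [hl]))]
    refine ⟨⟨hf.tab, hf.out, ?_, ?_, hf.wt⟩, hw, ?_⟩
    · intro r hr5
      simp only [Set.mem_singleton_iff] at hr5
      simp [Instr.run, hr5, hf.num]
    · simp [Instr.run, hr.one, hf.val]
    · simp only [Instr.run, hr.one, Function.update_self, hc, List.map_append, List.map_cons,
        List.map_nil, ← List.cons_append, walk_concat, hf.tab]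
  · refine ⟨⟨rfl, rfl, ?_, rfl, fun _ _ => rfl⟩, rfl, ?_⟩
    · intro r hr5
      simp only [Set.mem_singleton_iff] at hr5
      simp [Instr.run, hr5]
    · simp [Instr.run, hσ.zero, walk]

theorem reach_checkConsistent (hσ : Ready σ t) (h7 : σ.num 7 = 1) :
    Reach D (checkConsistent i) σ (Q.arity (Q.rel i) * 6 + 1) fun τ =>
      Frame {7} σ τ ∧ τ.wt 0 = σ.wt 0 ∧ (τ.num 7 = 1 ↔ Consistent D i t) := by
  refine (Reach.mono (B₁ := (List.finRange (Q.arity (Q.rel i))).length * 6 + 1)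
    (Reach.seqList (List.finRange (Q.arity (Q.rel i))) _ (fun pre τ => Frame {7} σ τ ∧
    τ.wt 0 = σ.wt 0 ∧
    (τ.num 7 = 1 ↔ ∀ c ∈ pre, (D (Q.rel i)).row t c = tupleVal D i t (Q.var i c)))
    ?_ ?_) (by simp) (by simp [Consistent]))
  · rintro pre c suf - τ ⟨hf, hw, hc⟩
    have hr := hσ.frame hf (by simp)
    refine (Reach.seq (B₁ := 3) (B₂ := 3) (Reach.ops ?_))
    simp only [List.foldl_cons, List.foldl_nil]
    rw [run_inVal hr.idx 1 c, run_inVal_pos (t := t) (by exact hr.idx) 2 (CQ.var_mem i c)]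
    refine Reach.ite (B := 2) (fun hb => ?_) (fun hb => ?_) <;>
      simp only [Test.Holds, hr.one, hr.two, Function.update_self, ne_eq,
        OfNat.one_ne_ofNat, not_false_eq_true, Function.update_of_ne] at hb
    · refine (Reach.skip ?_).mono (by omega) fun _ => id
      refine ⟨⟨hf.tab, hf.out, hf.num, ?_, hf.wt⟩, hw, ?_⟩
      · simp [hr.one, hr.two, hf.val]
      · simp [hc, or_imp, forall_and, hb]
    · refine Reach.ops ?_
      simp only [List.foldl_cons, List.foldl_nil]
      refine ⟨⟨hf.tab, hf.out, ?_, ?_, hf.wt⟩, hw, ?_⟩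
      · intro r hr7
        simp only [Set.mem_singleton_iff] at hr7
        simp [Instr.run, hr7, hf.num]
      · simp [Instr.run, hr.one, hr.two, hf.val]
      · simp [Instr.run, or_imp, forall_and, hb]
  · exact ⟨Frame.refl _ _, rfl, by simp [h7]⟩

variable (J) in
/-- The machine state represents the messages `M`. -/
structure Represents (σ : State A W) (M : Fin Q.numAtoms → List A → Option W) : Prop where
  trie : IsTrie σ.tab (10 + Q.numAtoms) (σ.num 8)
  zero : σ.num 0 = 0
  one : σ.num 1 = 1
  two : σ.num 2 = 2
  val : σ.val 0 = Classical.arbitrary A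
  wt : ∀ L, σ.num 8 ≤ L → σ.wt L = 0
  -- The cells of `N` at trie nodes stay clear for use as marks when the output is written.
  num : ∀ L, 10 ≤ L → σ.num L = 0
  out : ∀ j, σ.out j = []
  some_iff : ∀ i κ w, M i κ = some w ↔ κ.length = (J.sep i).length ∧
    walk σ.tab (10 + i) (Classical.arbitrary A :: κ) ≠ 0 ∧
    σ.wt (walk σ.tab (10 + i) (Classical.arbitrary A :: κ)) = w

variable {M : Fin Q.numAtoms → List A → Option W}

theorem Represents.frame {S : Set ℕ} {τ : State A W} (h : Represents J σ M) (hf : Frame S σ τ)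
    (hS : ∀ r ∈ S, 2 < r ∧ r < 8) : Represents J τ M := by
  have hn : ∀ r, r ≤ 2 ∨ 8 ≤ r → τ.num r = σ.num r := fun r hr =>
    hf.num r fun h => by have := hS r h; omega
  have h8 := hn 8 (by omega)
  refine ⟨?_, ?_, ?_, ?_, hf.val.trans h.val, ?_, ?_, ?_, ?_⟩
  · rw [hf.tab, h8]; exact h.trie
  · rw [hn 0 (by omega), h.zero]
  · rw [hn 1 (by omega), h.one]
  · rw [hn 2 (by omega), h.two]
  · intro L hL
    have := h.trie.pos.trans_le h.trie.le
    rw [h8] at hL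
    rw [hf.wt L (by omega), h.wt L hL]
  · intro L hL
    rw [hn L (by omega), h.num L hL]
  · intro j; rw [hf.out, h.out]
  · intro i κ w
    rw [hf.tab, h.some_iff]
    refine and_congr_right fun _ => and_congr_right fun h0 => ?_
    rw [hf.wt _ h0]

theorem reach_collect (hσ : Ready σ t) (hM : Represents J σ M)
    (h7 : σ.num 7 = 1 ↔ Consistent D i t) (hw : σ.wt 0 = (D (Q.rel i)).weight t) {s : ℕ}
    (hs : ∀ j, (J.sep j).length ≤ s) :
    Reach D (collect J i) σ ((J.kids i).length * (s * 3 + 9) + 1) fun τ =>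
      Frame {5, 7} σ τ ∧ (τ.num 7 = 1 ↔ (contrib J D M i t).isSome) ∧
        (τ.num 7 = 1 → contrib J D M i t = some (τ.wt 0)) := by
  refine (Reach.seqList (J.kids i) _ (fun pre τ => Frame {5, 7} σ τ ∧
      (τ.num 7 = 1 ↔ Consistent D i t ∧ ∀ j ∈ pre, (M j (key J D i t j)).isSome) ∧
      (τ.num 7 = 1 → (D (Q.rel i)).weight t *
        (pre.map fun j => (M j (key J D i t j)).getD 1).prod = τ.wt 0)) ?_ ?_).mono le_rfl ?_
  · rintro pre j suf hl τ ⟨hf, h7, hw⟩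
    have hr := hσ.frame hf (by simp)
    have hMτ := hM.frame hf (by simp)
    have hj : J.par j = some i := J.mem_kids.1 (by simp [hl])
    have hlk := reach_lookup (J := J) (j := j) hr fun x hx => by
      simpa [hj] using (J.mem_sep.1 hx).2
    refine ((hlk.mono (B := s * 3 + 4) (by linarith [hs j]) fun ρ h => ?_).seq (B₂ := 5)).mono
      (by omega) fun _ => id
    obtain ⟨hf', hw', h5⟩ := h
    have hMj := hMτ.some_iff j (key J D i t j)
    rw [← hMτ.val, ← h5] at hMj
    have hlen : (key J D i t j).length = (J.sep j).length := by simp [key]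
    have hrρ := hr.frame hf' (by simp)
    have hf5 : Frame {5, 7} τ ρ := hf'.mono (by simp)
    have h7ρ : ρ.num 7 = τ.num 7 := hf'.num 7 (by simp)
    refine (Reach.seq (B₁ := 3) (B₂ := 2) (Reach.ite (B := 2) (fun hb => ?_) fun hb => ?_)) <;>
      simp only [Test.Holds, hrρ.zero] at hb
    · refine Reach.ops (Reach.ops ?_)
      have hnone : M j (key J D i t j) = none := by
        rw [Option.eq_none_iff_forall_ne_some]
        intro w h
        exact ((hMj w).1 h).2.1 hb
      refine ⟨hf.trans (hf5.trans ⟨rfl, rfl, ?_, rfl, ?_⟩), ?_, ?_⟩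
      · intro r hr
        simp only [Set.mem_insert_iff, Set.mem_singleton_iff, not_or] at hr
        simp [Instr.run, hr.2]
      · intro L hL
        simp [Instr.run, hL, hrρ.zero]
      · simp [Instr.run, or_imp, forall_and, hnone]
      · simp [Instr.run]
    · refine (Reach.skip (Reach.ops ?_)).mono (by omega) fun _ => id
      have hsome : M j (key J D i t j) = some (τ.wt (ρ.num 5)) := (hMj _).2 ⟨hlen, hb, rfl⟩
      refine ⟨hf.trans (hf5.trans ⟨rfl, rfl, fun r _ => rfl, rfl, ?_⟩), ?_, ?_⟩
      · intro L hL
        simp [Instr.run, hL, hrρ.zero]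
      · simp [Instr.run, or_imp, forall_and, hsome, h7ρ, h7]
      · intro h
        simp only [Instr.run, List.foldl_cons, List.foldl_nil, h7ρ] at h
        simp [Instr.run, hsome, hrρ.zero, ← mul_assoc, hw h, hw', hf'.wt _ hb]
  · exact ⟨Frame.refl _ _, by simpa using h7, by simp [hw]⟩
  · rintro τ ⟨hf, h7, hw⟩
    refine ⟨hf, ?_, fun h => (contrib_eq_some J D).2 ⟨(h7.1 h).1, (h7.1 h).2, hw h⟩⟩
    rw [h7, Option.isSome_iff_exists]
    constructor
    · exact fun h => ⟨_, (contrib_eq_some J D).2 ⟨h.1, h.2, rfl⟩⟩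
    · rintro ⟨w, h⟩
      have := (contrib_eq_some J D).1 h
      exact ⟨this.1, this.2.1⟩

end Correctness

/-! ### Adding a contribution to a message -/

section Insertion

variable {Z : Finset ℕ} {A W : Type*} {Q : CQ Z}

/-- The current node has path `pre` in the trie of `i`, and only nodes on this path have been
created since state `σ`. -/
structure Descended (i : Fin Q.numAtoms) (σ : State A W) (pre : List A) (τ : State A W) :
    Prop where
  trie : IsTrie τ.tab (10 + Q.numAtoms) (τ.num 8)
  le : σ.num 8 ≤ τ.num 8
  cur : τ.num 5 = walk τ.tab (10 + i) pre
  ne : τ.num 5 ≠ 0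
  wt : τ.wt = σ.wt
  out : τ.out = σ.out
  num : ∀ r, r ≠ 5 → r ≠ 6 → r ≠ 8 → τ.num r = σ.num r
  val : τ.val 0 = σ.val 0
  -- A newly created node lies at or beyond the old bound, so by `Represents.wt` its weight is still
  -- `0`.
  walk_eq : ∀ (j : Fin Q.numAtoms) l, walk τ.tab (10 + j) l = walk σ.tab (10 + j) l ∨
    (j = i ∧ l <+: pre ∧ walk σ.tab (10 + j) l = 0 ∧ σ.num 8 ≤ walk τ.tab (10 + j) l)

variable {i : Fin Q.numAtoms} {σ τ : State A W} {pre : List A}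

theorem Descended.ready {k : ℕ} (h : Descended i σ pre τ) (hσ : Ready σ k) : Ready τ k :=
  ⟨(h.num 0 (by simp) (by simp) (by simp)).trans hσ.zero,
    (h.num 1 (by simp) (by simp) (by simp)).trans hσ.one,
    (h.num 2 (by simp) (by simp) (by simp)).trans hσ.two,
    (h.num 3 (by simp) (by simp) (by simp)).trans hσ.idx⟩

variable [SelectiveDioid W] {D : Database Q A W}

theorem reach_descend (h : Descended i σ pre τ) (h₀ : τ.num 0 = 0) (h₁ : τ.num 1 = 1)
    {b : ℕ} (hb : b < 5) :
    Reach D (descend b) τ 9 fun ρ =>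
      Descended i σ (pre ++ [τ.val (τ.num b)]) ρ := by
  classical
  have hb5 : b ≠ 5 := by omega
  have hb6 : b ≠ 6 := by omega
  have hb8 : b ≠ 8 := by omega
  have hlt : 10 + (i : ℕ) < 10 + Q.numAtoms := by have := i.2; omega
  set v := τ.val (τ.num b) with hv
  have hpre : ∀ l, l <+: pre → l <+: pre ++ [v] := fun l hl => hl.trans (List.prefix_append _ _)
  refine Reach.seq (B₁ := 2) (B₂ := 7) (Reach.ops (Reach.seq (B₁ := 5) (B₂ := 2)
    (Reach.ite (B := 4) (fun ht => Reach.ops (Reach.ops ?_))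
      fun ht => (Reach.skip (Reach.ops ?_)).mono (by omega) fun _ => id))) <;>
    simp only [Test.Holds, List.foldl_cons, List.foldl_nil, Instr.run, Function.update_self,
      ne_eq, OfNat.zero_ne_ofNat, not_false_eq_true, Function.update_of_ne, h₀, ← hv] at ht
  · have hv0 : τ.tab (walk τ.tab (10 + i) pre) v = 0 := by rw [← h.cur]; exact ht
    obtain ⟨htrie, hnew, hold⟩ := h.trie.extend hlt (h.cur ▸ h.ne) hv0
    rw [← h.cur] at htrie hnew hold
    have hpos : 0 < τ.num 8 := h.trie.pos.trans_le h.trie.le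
    have hnone : walk σ.tab (10 + i) (pre ++ [v]) = 0 := by
      have hw : walk τ.tab (10 + i) (pre ++ [v]) = 0 := by rw [walk_concat, hv0]
      rcases h.walk_eq i (pre ++ [v]) with h1 | h1
      · rw [← h1, hw]
      · exact h1.2.2.1
    suffices hs : ∀ ρ : State A W, ρ.tab = Function.update τ.tab (τ.num 5)
        (Function.update (τ.tab (τ.num 5)) v (τ.num 8)) → ρ.num 5 = τ.num 8 →
        ρ.num 8 = τ.num 8 + 1 → (∀ r, r ≠ 5 → r ≠ 6 → r ≠ 8 → ρ.num r = τ.num r) →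
        ρ.val = τ.val → ρ.wt = τ.wt → ρ.out = τ.out → Descended i σ (pre ++ [v]) ρ by
      refine hs _ ?_ ?_ ?_ ?_ rfl rfl rfl
      · simp [Instr.run, hb6, ← hv]
      · simp [Instr.run, hb6, ← hv, h₀]
      · simp [Instr.run, h₁]
      · intro r h5 h6 h8
        simp [Instr.run, h5, h6, h8]
    intro ρ hρt h5 h8 hn hval hwt hout
    rw [← hρt] at htrie hnew hold
    refine ⟨h8 ▸ htrie, by have := h.le; omega, by rw [h5, hnew], by omega, hwt.trans h.wt,
      hout.trans h.out, fun r r5 r6 r8 => (hn r r5 r6 r8).trans (h.num r r5 r6 r8),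
      (by rw [hval, h.val]), fun j l => ?_⟩
    by_cases hj : j = i ∧ l = pre ++ [v]
    · obtain ⟨rfl, rfl⟩ := hj
      exact .inr ⟨rfl, List.prefix_rfl, hnone, by rw [hnew]; exact h.le⟩
    · rw [hold (10 + j) l (by have := j.2; omega) fun hh => hj ⟨Fin.ext (by omega), hh.2⟩]
      exact (h.walk_eq j l).imp id fun hh => ⟨hh.1, hpre l hh.2.1, hh.2.2⟩
  · suffices hs : ∀ ρ : State A W, ρ.tab = τ.tab → ρ.num 5 = τ.tab (τ.num 5) v →
        ρ.num 8 = τ.num 8 → (∀ r, r ≠ 5 → r ≠ 6 → r ≠ 8 → ρ.num r = τ.num r) →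
        ρ.val = τ.val → ρ.wt = τ.wt → ρ.out = τ.out → Descended i σ (pre ++ [v]) ρ by
      refine hs _ rfl ?_ ?_ ?_ rfl rfl rfl
      · simp [Instr.run, ← hv, h₀]
      · simp [Instr.run]
      · intro r h5 h6 h8
        simp [Instr.run, h5, h6]
    intro ρ ht' h5 h8 hn hval hwt hout
    refine ⟨by rw [ht', h8]; exact h.trie, by rw [h8]; exact h.le, ?_, by rwa [h5],
      hwt.trans h.wt, hout.trans h.out, fun r r5 r6 r8 => (hn r r5 r6 r8).trans (h.num r r5 r6 r8),
      (by rw [hval, h.val]), fun j l => ?_⟩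
    · rw [h5, ht', walk_concat, h.cur]
    · rw [ht']
      exact (h.walk_eq j l).imp id fun hh => ⟨hh.1, hpre l hh.2.1, hh.2.2⟩

variable [Nonempty A] {J : RootedJoinTree Q.atomVars Z} {t : Fin (D (Q.rel i)).card}
  {M : Fin Q.numAtoms → List A → Option W}

theorem reach_insertKey (hσ : Ready σ t) (hM : Represents J σ M) :
    Reach D (insertKey J i) σ ((J.sep i).length * 11 + 12)
      (Descended i σ (σ.val 0 :: key J D i t i)) := by
  refine (Reach.seq (B₁ := 2) (B₂ := 9 + ((J.sep i).length * 11 + 1)) (Reach.ops ?_)).mono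
    (by omega) fun _ => id
  have h₀ : Descended i σ [] ((Instr.const 5 (10 + i)).run D σ) := by
    refine ⟨hM.trie, le_rfl, ?_, ?_, rfl, rfl, ?_, rfl, fun _ _ => .inl rfl⟩
    · simp [Instr.run]
    · simp [Instr.run]
    · intro r h5 h6 h8
      simp [Instr.run, h5]
  have hr₀ := h₀.ready hσ
  refine Reach.seq ((reach_descend h₀ hr₀.zero hr₀.one (b := 0) (by omega)).mono le_rfl
    fun τ hτ => ?_)
  rw [hr₀.zero] at hτ
  refine Reach.seqList (J.sep i) _
    (fun pre => Descended i σ (σ.val 0 :: pre.map (tupleVal D i t))) ?_ hτ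
  rintro pre x suf hl τ hτ
  have hr := hτ.ready hσ
  refine Reach.seq (B₁ := 2) (B₂ := 9) (Reach.ops ?_)
  simp only [List.foldl_cons, List.foldl_nil]
  rw [run_inVal_pos hr.idx 1 (J.mem_sep.1 (by simp [hl] : x ∈ J.sep i)).1, hr.one]
  have hd : Descended i σ (σ.val 0 :: pre.map (tupleVal D i t))
      { τ with val := Function.update τ.val 1 (tupleVal D i t x) } :=
    ⟨hτ.trie, hτ.le, hτ.cur, hτ.ne, hτ.wt, hτ.out, hτ.num, by simpa using hτ.val, hτ.walk_eq⟩
  refine (reach_descend hd hr.zero hr.one (b := 1) (by omega)).mono le_rfl fun ρ hρ => ?_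
  simpa [hr.one] using hρ

open Classical in
/-- The messages `M` after adding the contribution `w` to the message of `i` at `κ`. -/
noncomputable def addContrib (M : Fin Q.numAtoms → List A → Option W) (i : Fin Q.numAtoms)
    (κ : List A) (w : W) : Fin Q.numAtoms → List A → Option W :=
  Function.update M i (Function.update (M i) κ (some ((M i κ).elim w (· + w))))

/-- Insertion may create nodes for every prefix of the key, but all keys of one atom have the same
length. Hence only the message at `κ` itself is affected. -/
theorem Descended.represents_add {κ : List A} (hM : Represents J σ M)
    (hκ : κ.length = (J.sep i).length) (h : Descended i σ (σ.val 0 :: κ) τ) (w : W) :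
    Represents J { τ with wt := Function.update τ.wt (τ.num 5) (τ.wt (τ.num 5) + w) }
      (addContrib M i κ w) := by
  classical
  have hn : ∀ r, r ≠ 5 → r ≠ 6 → r ≠ 8 → τ.num r = σ.num r := h.num
  have hi := i.2
  have hcur := h.cur
  rw [hM.val] at hcur
  have hcur_lt : τ.num 5 < τ.num 8 := by rw [hcur]; exact h.trie.walk_lt (by omega)
  refine ⟨h.trie, ?_, ?_, ?_, h.val.trans hM.val, ?_, ?_, ?_, ?_⟩
  · exact (hn 0 (by simp) (by simp) (by simp)).trans hM.zero
  · exact (hn 1 (by simp) (by simp) (by simp)).trans hM.one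
  · exact (hn 2 (by simp) (by simp) (by simp)).trans hM.two
  · intro L hL
    dsimp only at hL ⊢
    rw [Function.update_of_ne (by omega), h.wt, hM.wt L (h.le.trans hL)]
  · intro L hL
    exact (hn L (by omega) (by omega) (by omega)).trans (hM.num L hL)
  · intro j
    exact (congrFun h.out j).trans (hM.out j)
  · intro j l w'
    by_cases hj : j = i ∧ l = κ
    · obtain ⟨rfl, rfl⟩ := hj
      simp only [addContrib, Function.update_self, Option.some.injEq, ← hcur, hκ, h.ne, ne_eq,
        not_false_eq_true, true_and]
      have : (M j l).elim w (· + w) = τ.wt (τ.num 5) + w := by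
        cases hm : M j l with
        | some v =>
          obtain ⟨-, h1, h2⟩ := (hM.some_iff j l v).1 hm
          rcases h.walk_eq j (Classical.arbitrary A :: l) with h3 | h3
          · rw [h.wt, hcur, h3, h2]; rfl
          · exact absurd h3.2.2.1 h1
        | none =>
          have h1 : walk σ.tab (10 + j) (Classical.arbitrary A :: l) = 0 := by
            by_contra h1
            have := (hM.some_iff j l _).2 ⟨hκ, h1, rfl⟩
            simp [hm] at this
          rcases h.walk_eq j (Classical.arbitrary A :: l) with h3 | h3
          · exact absurd (hcur.trans (h3.trans h1)) h.ne
          -- The node is new and has weight `0`, so the sum is just `w`.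
          · rw [h.wt, hM.wt _ (hcur ▸ h3.2.2.2)]; simp
      rw [this]
    · have hadd : addContrib M i κ w j l = M j l := by
        unfold addContrib
        by_cases hji : j = i
        · subst hji
          rw [Function.update_self, Function.update_of_ne fun h => hj ⟨rfl, h⟩]
        · rw [Function.update_of_ne hji]
      rw [hadd, hM.some_iff]
      refine and_congr_right fun hl => ?_
      have hw : walk τ.tab (10 + j) (Classical.arbitrary A :: l) =
          walk σ.tab (10 + j) (Classical.arbitrary A :: l) := by
        rcases h.walk_eq j (Classical.arbitrary A :: l) with h3 | ⟨rfl, h3, -⟩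
        · exact h3
        -- A prefix of the inserted path with the full length is the path itself.
        · have := h3.eq_of_length (by simp [hl, hκ])
          exact absurd ⟨rfl, (List.cons.inj this).2⟩ hj
      rw [← hw]
      refine and_congr_right fun h0 => ?_
      dsimp only
      rw [Function.update_of_ne, h.wt]
      intro he
      obtain ⟨h1, h2⟩ := h.trie.walk_inj (by have := j.2; omega) (by omega) (he.trans hcur) h0
      exact hj ⟨Fin.ext (by omega), (List.cons.inj h2).2⟩

/-- The messages after processing tuple `t` of atom `i`. -/
noncomputable def stepMessage (J : RootedJoinTree Q.atomVars Z) (D : Database Q A W)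
    (M : Fin Q.numAtoms → List A → Option W) (i : Fin Q.numAtoms)
    (t : Fin (D (Q.rel i)).card) : Fin Q.numAtoms → List A → Option W :=
  (contrib J D M i t).elim M (addContrib M i (key J D i t i))

theorem reach_processTuple {s : ℕ} (hk : (J.kids i).length ≤ s)
    (ha : Q.arity (Q.rel i) ≤ s) (hs : ∀ j, (J.sep j).length ≤ s)
    (hσ : Ready σ t) (hM : Represents J σ M) :
    Reach D (processTuple J i) σ (3 * s * s + 26 * s + 20) fun τ =>
      Ready τ t ∧ τ.num 4 = σ.num 4 ∧ Represents J τ (stepMessage J D M i t) := by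
  -- The bounds belong to the initialisation, the consistency check, the messages of the children,
  -- and the guarded insertion.
  refine (Reach.seq (B₁ := 3) (B₂ := (s * 6 + 1) + ((s * (s * 3 + 9) + 1) + (s * 11 + 12 + 2 + 1)))
    (Reach.ops ?_)).mono (by nlinarith) fun _ => id
  simp only [List.foldl_cons, List.foldl_nil]
  rw [run_inWt (k := t) (by simpa [Instr.run] using hσ.idx)]
  have hr0 : ((Instr.const 7 1).run D σ).num 0 = 0 := by simp [Instr.run, hσ.zero]
  rw [hr0]
  set σ₁ : State A W := { (Instr.const 7 1).run D σ with
    wt := Function.update ((Instr.const 7 1).run D σ).wt 0 ((D (Q.rel i)).weight t) } with hσ₁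
  have hf₁ : Frame {5, 7} σ σ₁ := by
    refine ⟨rfl, rfl, ?_, rfl, ?_⟩
    · intro r hr
      simp only [Set.mem_insert_iff, Set.mem_singleton_iff, not_or] at hr
      simp [hσ₁, Instr.run, hr.2]
    · intro L hL
      simp [hσ₁, Instr.run, hL]
  have h7 : σ₁.num 7 = 1 := by simp [hσ₁, Instr.run]
  have hw : σ₁.wt 0 = (D (Q.rel i)).weight t := by simp [hσ₁]
  have hr₁ := hσ.frame hf₁ (by simp)
  refine Reach.seq ((reach_checkConsistent hr₁ h7).mono (by omega) fun σ₂ h₂ => ?_)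
  obtain ⟨hf₂, hw₂, hc₂⟩ := h₂
  have hf₂ := hf₁.trans (hf₂.mono (by simp))
  have hr₂ := hσ.frame hf₂ (by simp)
  refine Reach.seq ((reach_collect hr₂ (hM.frame hf₂ (by simp)) hc₂ (hw₂.trans hw) hs).mono
    (by nlinarith) fun σ₃ h₃ => ?_)
  obtain ⟨hf₃, hc₃, hw₃⟩ := h₃
  have hf₃ := hf₂.trans hf₃
  have hr₃ := hσ.frame hf₃ (by simp)
  have hM₃ := hM.frame hf₃ (by simp)
  have h4 : σ₃.num 4 = σ.num 4 := hf₃.num 4 (by simp)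
  refine Reach.ite (fun hb => ?_) fun hb => ?_ <;> simp only [Test.Holds, hr₃.one] at hb
  · refine Reach.seq (B₁ := s * 11 + 12) (B₂ := 2) ((reach_insertKey hr₃ hM₃).mono
      (by linarith [hs i]) fun τ hτ => Reach.ops ?_)
    have hlen : (key J D i t i).length = (J.sep i).length := by simp [key]
    have hr := hτ.ready hr₃
    have hrep := hτ.represents_add hM₃ hlen (σ₃.wt 0)
    simp only [List.foldl_cons, List.foldl_nil, Instr.run, hr.zero]
    rw [stepMessage, hw₃ hb, Option.elim_some, hτ.wt]
    rw [hτ.wt] at hrep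
    exact ⟨⟨hr.zero, hr.one, hr.two, hr.idx⟩,
      (hτ.num 4 (by simp) (by simp) (by simp)).trans h4, hrep⟩
  · refine (Reach.skip ⟨hr₃, h4, ?_⟩).mono (by omega) fun _ => id
    have hnone : contrib J D M i t = none := by
      rw [← Option.not_isSome_iff_eq_none, ← hc₃]; exact hb
    rwa [stepMessage, hnone]

end Insertion

/-! ### Messages of all atoms, children before parents -/

theorem RootedJoinTree.exists_order {m : ℕ} {e : Fin m → Finset ℕ} {Z : Finset ℕ}
    (J : RootedJoinTree e Z) : ∃ l : List (Fin m), l.length = m ∧ l.Nodup ∧ (∀ i, i ∈ l) ∧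
      l.Pairwise fun a b => J.depth b ≤ J.depth a := by
  have hp := List.mergeSort_perm (List.finRange m) fun a b => decide (J.depth b ≤ J.depth a)
  refine ⟨_, by simp, hp.nodup_iff.2 (List.nodup_finRange m),
    fun i => hp.mem_iff.2 (List.mem_finRange i), ?_⟩
  refine (List.pairwise_mergeSort ?_ ?_ (List.finRange m)).imp (by simp)
  · intro a b c h1 h2
    simp only [decide_eq_true_eq] at *
    omega
  · intro a b
    simp only [Bool.or_eq_true, decide_eq_true_eq]
    omega

section BottomUp

variable {Z : Finset ℕ} {A W : Type*} {Q : CQ Z} [SelectiveDioid W] [Nonempty A]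
  {J : RootedJoinTree Q.atomVars Z} {D : Database Q A W} {i : Fin Q.numAtoms}
  {M M' : Fin Q.numAtoms → List A → Option W}

theorem contrib_congr (h : ∀ j ∈ J.kids i, M' j = M j) (t : Fin (D (Q.rel i)).card) :
    contrib J D M' i t = contrib J D M i t := by
  ext w
  rw [contrib_eq_some, contrib_eq_some]
  have h1 : ((J.kids i).map fun j => (M' j (key J D i t j)).getD 1) =
      (J.kids i).map fun j => (M j (key J D i t j)).getD 1 :=
    List.map_congr_left fun j hj => by rw [h j hj]
  have h2 : (∀ j ∈ J.kids i, (M' j (key J D i t j)).isSome) ↔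
      ∀ j ∈ J.kids i, (M j (key J D i t j)).isSome :=
    forall₂_congr fun j hj => by rw [h j hj]
  rw [h1, h2]

theorem ne_of_mem_kids {j : Fin Q.numAtoms} (h : j ∈ J.kids i) : j ≠ i := by
  rintro rfl
  have := J.depth_child j j (J.mem_kids.1 h)
  omega

/-- A finished message stays valid while atoms other than `i` and its children are processed. -/
theorem IsMessage.congr (hM : IsMessage J D M i) (hi : M' i = M i)
    (h : ∀ j ∈ J.kids i, M' j = M j) : IsMessage J D M' i := by
  constructor
  · intro κ w hw
    rw [hi] at hw
    obtain ⟨t, h1, h2⟩ := hM.sound κ w hw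
    exact ⟨t, h1, by rw [contrib_congr h, h2]⟩
  · intro t w hw
    rw [contrib_congr h] at hw
    rw [hi]
    exact hM.complete t w hw

variable (J D) in
/-- `M i` consists of the minimal contributions of the first `k` tuples of `i`. -/
structure IsPartialMessage (M : Fin Q.numAtoms → List A → Option W) (i : Fin Q.numAtoms)
    (k : ℕ) : Prop where
  sound : ∀ κ w, M i κ = some w → ∃ t, t.val < k ∧ key J D i t i = κ ∧ contrib J D M i t = some w
  complete : ∀ t w, t.val < k → contrib J D M i t = some w →
    ∃ w', M i (key J D i t i) = some w' ∧ Before w' w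

theorem stepMessage_of_ne {j : Fin Q.numAtoms} (hj : j ≠ i) (t : Fin (D (Q.rel i)).card) :
    stepMessage J D M i t j = M j := by
  unfold stepMessage
  cases contrib J D M i t with
  | none => rfl
  | some w => simp [addContrib, hj]

/-- Contributions to `i` depend only on the children of `i`, so they are unaffected by the update.
Selectivity keeps the new value equal to the contribution of a single tuple, the earlier one or `t`.
-/
theorem IsPartialMessage.step {t : Fin (D (Q.rel i)).card}
    (h : IsPartialMessage J D M i t) : IsPartialMessage J D (stepMessage J D M i t) i (t + 1) := by
  classical
  have hc : ∀ u, contrib J D (stepMessage J D M i t) i u = contrib J D M i u :=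
    contrib_congr fun j hj => stepMessage_of_ne (ne_of_mem_kids hj) t
  cases hw : contrib J D M i t with
  | none =>
    have hs : stepMessage J D M i t = M := by simp [stepMessage, hw]
    rw [hs]
    constructor
    · intro κ w hκ
      obtain ⟨u, h1, h2⟩ := h.sound κ w hκ
      exact ⟨u, by omega, h2⟩
    · intro u w hu hwu
      have : u ≠ t := by rintro rfl; simp [hw] at hwu
      exact h.complete u w (by have : u.val ≠ t.val := fun hh => this (Fin.ext hh)
                               omega) hwu
  | some w =>
    have hs : ∀ κ, stepMessage J D M i t i κ = if κ = key J D i t i then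
        some ((M i κ).elim w (· + w)) else M i κ := by
      intro κ
      by_cases hκ : κ = key J D i t i
      · subst hκ; simp [stepMessage, hw, addContrib]
      · simp [stepMessage, hw, addContrib, hκ]
    constructor
    · intro κ v hκ
      simp only [hc]
      rw [hs] at hκ
      split at hκ
      · rename_i he
        subst he
        cases hm : M i (key J D i t i) with
        | none =>
          rw [hm] at hκ
          exact ⟨t, by omega, rfl, hw.trans hκ⟩
        | some v' =>
          rw [hm] at hκ
          simp only [Option.elim_some, Option.some.injEq] at hκ
          obtain ⟨u, h1, h2, h3⟩ := h.sound _ _ hm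
          rcases SelectiveDioid.selective v' w with h4 | h4
          · exact ⟨u, by omega, h2, by rw [h3, ← hκ, h4]⟩
          · exact ⟨t, by omega, rfl, by rw [hw, ← hκ, h4]⟩
      · obtain ⟨u, h1, h2⟩ := h.sound κ v hκ
        exact ⟨u, by omega, h2⟩
    · intro u v hu hv
      rw [hc] at hv
      rw [hs]
      by_cases hut : u = t
      · subst hut
        obtain rfl : w = v := by simpa [hw] using hv
        rw [if_pos rfl]
        refine ⟨_, rfl, ?_⟩
        cases M i (key J D i u i) with
        | none => exact Before.refl w
        | some v' => exact before_add_right v' w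
      · obtain ⟨w', h1, h2⟩ := h.complete u v
          (by have : u.val ≠ t.val := fun hh => hut (Fin.ext hh)
              omega) hv
        split
        · refine ⟨_, rfl, ?_⟩
          rw [h1]
          exact (before_add_left w' w).trans h2
        · exact ⟨w', h1, h2⟩

variable (J) in
/-- Compute the message of atom `i`. -/
noncomputable def processAtom (i : Fin Q.numAtoms) : Prog :=
  forTuples (Q.rel i) (processTuple J i)

variable {σ : State A W}

theorem reach_processAtom {s n : ℕ} (hm : Q.numAtoms ≤ s) (ha : ∀ i, Q.arity (Q.rel i) ≤ s)
    (hn : (D (Q.rel i)).card ≤ n) (hM : Represents J σ M) (hi : M i = fun _ => none) :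
    Reach D (processAtom J i) σ (n * (3 * s * s + 26 * s + 20 + 2) + 4) fun τ =>
      ∃ M', Represents J τ M' ∧ (∀ j ≠ i, M' j = M j) ∧ IsMessage J D M' i := by
  have hsep : ∀ j, (J.sep j).length ≤ s := fun j =>
    (J.length_sep_le j).trans ((CQ.card_atomVars_le j).trans (ha j))
  refine (Reach.forTuples (B := 3 * s * s + 26 * s + 20) (fun k τ => τ.num 3 = k ∧
    τ.num 4 = (D (Q.rel i)).card ∧ ∃ M', Represents J τ M' ∧ (∀ j ≠ i, M' j = M j) ∧
      IsPartialMessage J D M' i k) ?_ ?_ ?_).mono (by gcongr) ?_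
  · rintro k τ ⟨h3, h4, M', h, -⟩
    exact ⟨h.one, h3, h4⟩
  · refine ⟨by simp, by simp, M, hM.frame (S := {3, 4}) ⟨rfl, rfl, ?_, rfl, fun _ _ => rfl⟩
      (by simp), fun _ _ => rfl, ⟨by simp [hi], by simp⟩⟩
    intro r hr
    simp only [Set.mem_insert_iff, Set.mem_singleton_iff, not_or] at hr
    simp [hr.1, hr.2]
  · rintro k hk τ ⟨h3, h4, M', hM', hne, hpart⟩
    have hready : Ready τ (⟨k, hk⟩ : Fin (D (Q.rel i)).card) := ⟨hM'.zero, hM'.one, hM'.two, h3⟩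
    refine (reach_processTuple ((J.length_kids_le i).trans hm) (ha i) hsep hready hM').mono le_rfl
      fun ρ h => ?_
    obtain ⟨hr, h4', hrep⟩ := h
    refine ⟨hr.one, hr.idx, by simp, by simp [h4', h4], _, hrep.frame (S := {3})
      ⟨rfl, rfl, fun r hr => ?_, rfl, fun _ _ => rfl⟩ (by simp), fun j hj => ?_, hpart.step⟩
    · simp only [Set.mem_singleton_iff] at hr
      simp [hr]
    · rw [stepMessage_of_ne hj, hne j hj]
  · rintro τ ⟨-, -, M', hM', hne, hpart⟩
    refine ⟨M', hM', hne, ⟨fun κ w h => ?_, fun t w h => hpart.complete t w t.2 h⟩⟩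
    obtain ⟨t, -, h⟩ := hpart.sound κ w h
    exact ⟨t, h⟩

variable (J) in
/-- Compute the messages of all atoms, with children before their parents. -/
noncomputable def processAll : Prog :=
  .seq (ops [.const 1 1, .const 2 2, .const 8 (10 + Q.numAtoms)])
    (seqList (J.exists_order.choose.map (processAtom J)))

theorem reach_processAll {s n : ℕ} (hm : Q.numAtoms ≤ s) (ha : ∀ i, Q.arity (Q.rel i) ≤ s)
    (hn : ∀ i, (D (Q.rel i)).card ≤ n) :
    Reach D (processAll J) (State.start A W) (4 + (s * (n * (3 * s * s + 26 * s + 20 + 2) + 4) + 1))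
      fun τ => ∃ M, Represents J τ M ∧ ∀ i, IsMessage J D M i := by
  obtain ⟨hlen, hnd, hmem, hsort⟩ := J.exists_order.choose_spec
  refine Reach.seq (Reach.ops ?_)
  refine (Reach.seqList J.exists_order.choose _ (fun pre τ => ∃ M, Represents J τ M ∧
    (∀ i ∈ pre, IsMessage J D M i) ∧ ∀ i ∉ pre, M i = fun _ => none) ?_ ?_).mono
    (by rw [hlen]; gcongr) ?_
  · rintro pre i suf hl τ ⟨M, hM, hpre, hnone⟩
    rw [hl] at hnd hsort
    have hi : i ∉ pre := by
      have := List.disjoint_of_nodup_append hnd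
      exact fun h => this h (by simp)
    refine (reach_processAtom hm ha (hn i) hM (hnone i hi)).mono le_rfl fun ρ h => ?_
    obtain ⟨M', hM', hne, hmsg⟩ := h
    refine ⟨M', hM', fun j hj => ?_, fun j hj => ?_⟩
    · rw [List.mem_append, List.mem_singleton] at hj
      by_cases hji : j = i
      · rwa [hji]
      · have hjp := hj.resolve_right hji
        refine (hpre j hjp).congr (hne j hji) fun l hl' => hne l ?_
        -- The atom just processed is not a child of the earlier atom `j`: it would be deeper than
        -- `j`, against the order.
        rintro rfl
        have h1 := J.depth_child l j (J.mem_kids.1 hl')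
        have h2 := (List.pairwise_append.1 hsort).2.2 j hjp l (by simp)
        omega
    · rw [List.mem_append, List.mem_singleton, not_or] at hj
      rw [hne j hj.2, hnone j hj.1]
  · refine ⟨fun _ _ => none, ?_, by simp, fun _ _ => rfl⟩
    have hw : ∀ (i : ℕ) (l : List A), l ≠ [] → walk (fun _ _ => 0) i l = 0 := by
      intro i l hl
      obtain ⟨l, v, rfl⟩ := (List.eq_nil_or_concat l).resolve_left hl
      rw [List.concat_eq_append, walk_concat]
    refine ⟨?_, ?_, ?_, ?_, ?_, ?_, ?_, ?_, ?_⟩ <;>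
      simp only [List.foldl_cons, List.foldl_nil, Instr.run, State.start]
    · simpa using IsTrie.init (A := A) (by omega : 0 < 10 + Q.numAtoms)
    · simp
    · simp
    · simp
    · simp
    · intro L hL
      rw [Function.update_of_ne (by omega), Function.update_of_ne (by omega),
        Function.update_of_ne (by omega)]
    · simp
    · intro i κ w
      simp [hw]
  · rintro τ ⟨M, hM, hmsg, -⟩
    exact ⟨M, hM, fun i => hmsg i (hmem i)⟩

end BottomUp

/-! ### Writing the output -/

/-- A list of tuples without repetition is a relation. -/
theorem exists_wRel {A W : Type*} {k : ℕ} (l : List (List A × W)) 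
    (hk : ∀ p ∈ l, p.1.length = k) (hl : (l.map Prod.fst).Nodup) :
    ∃ R : WRel A W k, R.card = l.length ∧
      l = List.ofFn fun i => (List.ofFn (R.row i), R.weight i) := by
  have hrow : ∀ r : Fin l.length,
      List.ofFn (fun c : Fin k => (l.get r).1.get (c.cast (hk _ (List.get_mem l r)).symm)) =
        (l.get r).1 := by
    intro r
    apply List.ext_get
    · simpa using (hk _ (List.get_mem l r)).symm
    · intro n h1 h2
      simp
  refine ⟨⟨l.length, fun r c => (l.get r).1.get (c.cast (hk _ (List.get_mem l r)).symm), ?_,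
    fun r => (l.get r).2⟩, rfl, ?_⟩
  · intro r r' h
    have h1 : (l.get r).1 = (l.get r').1 := by
      rw [← hrow r, ← hrow r']
      exact congrArg List.ofFn h
    have h2 := List.nodup_iff_injective_get.1 hl
    have := @h2 (r.cast (by simp)) (r'.cast (by simp)) (by simpa using h1)
    exact Fin.ext (by simpa using congrArg Fin.val this)
  · simp only [hrow]
    exact (List.ofFn_get l).symm

section Output

variable {Z : Finset ℕ} {Q : CQ Z} (J : RootedJoinTree Q.atomVars Z)

/-- Write the key of the current tuple of atom `i` to `V[1], V[2], …`. -/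
noncomputable def loadKey (i : Fin Q.numAtoms) : Prog :=
  seqList ((List.finRange (J.sep i).length).map fun c =>
    ops [.const 6 (c.val + 1), .inVal 6 (Q.rel i) 3 (Q.pos i ((J.sep i).get c))])

/-- Output the message of the `j`-th child of the root at the key of the current tuple, if there is
one and it has not been output before. Nodes with `N[L] = 1` have been output. -/
noncomputable def emitTuple (j : Fin (Fintype.card {c // J.par c = none})) : Prog :=
  .seq (lookup J (rootChild J j).1 (rootChild J j).1)
    (.ite (.eqNum 5 0) .skip
      (.seq (ops [.load 6 5])
        (.ite (.eqNum 6 0)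
          (.seq (loadKey J (rootChild J j).1)
            (ops [.store 5 1, .emit j (J.sep (rootChild J j).1).length 1 5])) .skip)))

/-- Output the messages of the children of the root. -/
noncomputable def emitAll : Prog :=
  seqList ((List.finRange (Fintype.card {c // J.par c = none})).map fun j =>
    forTuples (Q.rel (rootChild J j).1) (emitTuple J j))

variable {A W : Type*} [Nonempty A] {D : Database Q A W}

variable (D) in
/-- Part of the messages `M` have been output, including those for the tuples in `P`. -/
structure Emitted (M : Fin Q.numAtoms → List A → Option W)
    (P : Fin (Fintype.card {c // J.par c = none}) → ℕ → Prop) (τ : State A W) : Prop where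
  trie : IsTrie τ.tab (10 + Q.numAtoms) (τ.num 8)
  zero : τ.num 0 = 0
  one : τ.num 1 = 1
  two : τ.num 2 = 2
  val : τ.val 0 = Classical.arbitrary A
  some_iff : ∀ i κ w, M i κ = some w ↔ κ.length = (J.sep i).length ∧
    walk τ.tab (10 + i) (Classical.arbitrary A :: κ) ≠ 0 ∧
    τ.wt (walk τ.tab (10 + i) (Classical.arbitrary A :: κ)) = w
  sound : ∀ j : Fin (Fintype.card {c // J.par c = none}), ∀ p ∈ τ.out j,
    M (rootChild J j).1 p.1 = some p.2
  nodup : ∀ j : Fin (Fintype.card {c // J.par c = none}), ((τ.out j).map Prod.fst).Nodup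
  mark : ∀ (j : Fin (Fintype.card {c // J.par c = none})) κ w, M (rootChild J j).1 κ = some w →
    (τ.num (walk τ.tab (10 + (rootChild J j).1) (Classical.arbitrary A :: κ)) = 0 ↔
      κ ∉ (τ.out j).map Prod.fst)
  done : ∀ j (t : Fin (D (Q.rel (rootChild J j).1)).card) w, P j t →
    M (rootChild J j).1 (key J D (rootChild J j).1 t (rootChild J j).1) = some w →
    key J D (rootChild J j).1 t (rootChild J j).1 ∈ (τ.out j).map Prod.fst

variable {J} {M : Fin Q.numAtoms → List A → Option W}
  {P P' : Fin (Fintype.card {c // J.par c = none}) → ℕ → Prop} {σ τ : State A W}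

theorem Emitted.frame {S : Set ℕ} (h : Emitted J D M P σ) (hf : Frame S σ τ)
    (hS : ∀ r ∈ S, 2 < r ∧ r < 8) : Emitted J D M P τ := by
  have hn : ∀ r, r ≤ 2 ∨ 8 ≤ r → τ.num r = σ.num r := fun r hr =>
    hf.num r fun h => by have := hS r h; omega
  refine ⟨?_, ?_, ?_, ?_, hf.val.trans h.val, ?_, ?_, ?_, ?_, ?_⟩
  · rw [hf.tab, hn 8 (by omega)]; exact h.trie
  · rw [hn 0 (by omega), h.zero]
  · rw [hn 1 (by omega), h.one]
  · rw [hn 2 (by omega), h.two]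
  · intro i κ w
    rw [hf.tab, h.some_iff]
    refine and_congr_right fun _ => and_congr_right fun h0 => ?_
    rw [hf.wt _ h0]
  · rw [hf.out]; exact h.sound
  · rw [hf.out]; exact h.nodup
  · intro j κ w hw
    -- Marks sit at trie nodes, at addresses from `10` on, out of reach of the temporary registers.
    have := h.trie.walk_ge (by simp) ((h.some_iff _ _ _).1 hw).2.1
    rw [hf.tab, hf.out, hn _ (by omega)]
    exact h.mark j κ w hw
  · rw [hf.out]; exact h.done

theorem Emitted.mono (h : Emitted J D M P σ)
    (hd : ∀ j (t : Fin (D (Q.rel (rootChild J j).1)).card) w, P' j t →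
      M (rootChild J j).1 (key J D (rootChild J j).1 t (rootChild J j).1) = some w →
      key J D (rootChild J j).1 t (rootChild J j).1 ∈ (σ.out j).map Prod.fst) :
    Emitted J D M P' σ :=
  ⟨h.trie, h.zero, h.one, h.two, h.val, h.some_iff, h.sound, h.nodup, h.mark, hd⟩

variable [SelectiveDioid W]

theorem Represents.emitted (h : Represents J σ M) : Emitted J D M (fun _ _ => False) σ := by
  refine ⟨h.trie, h.zero, h.one, h.two, h.val, h.some_iff, ?_, ?_, ?_, ?_⟩
  · simp [h.out]
  · simp [h.out]
  · intro j κ w hw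
    have := h.trie.walk_ge (by simp) ((h.some_iff _ _ _).1 hw).2.1
    simp [h.out, h.num _ ((Nat.le_add_right 10 _).trans this)]
  · simp

theorem reach_loadKey {i : Fin Q.numAtoms} {t : Fin (D (Q.rel i)).card} (hσ : Ready σ t) :
    Reach D (loadKey J i) σ ((J.sep i).length * 3 + 1) fun τ => Frame {6} σ τ ∧ τ.wt = σ.wt ∧
      (List.range (J.sep i).length).map (fun c => τ.val (1 + c)) = key J D i t i := by
  refine (Reach.mono (B₁ := (List.finRange (J.sep i).length).length * 3 + 1)
    (Reach.seqList (List.finRange (J.sep i).length) _ (fun pre τ => Frame {6} σ τ ∧ τ.wt = σ.wt ∧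
      ∀ c ∈ pre, τ.val (1 + c.val) = tupleVal D i t ((J.sep i).get c)) ?_ ?_) (by simp) ?_)
  · rintro pre c suf - τ ⟨hf, hw, hc⟩
    have hr := hσ.frame hf (by simp)
    refine Reach.ops ?_
    simp only [List.foldl_cons, List.foldl_nil]
    have hx : (J.sep i).get c ∈ Q.atomVars i := (J.mem_sep.1 (List.get_mem _ c)).1
    rw [run_inVal_pos (t := t) (by simpa [Instr.run] using hr.idx) 6 hx]
    refine ⟨⟨hf.tab, hf.out, ?_, ?_, hf.wt⟩, hw, ?_⟩
    · intro r hr6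
      simp only [Set.mem_singleton_iff] at hr6
      simp [Instr.run, hr6, hf.num]
    · simp [Instr.run, hf.val]
    · intro d hd
      simp only [Instr.run, Function.update_self]
      by_cases hdc : d = c
      · subst hdc; rw [add_comm, Function.update_self]
      · have hne : 1 + d.val ≠ c.val + 1 := fun h => hdc (Fin.ext (by omega))
        rw [Function.update_of_ne hne]
        refine hc d ?_
        simpa [hdc] using hd
  · exact ⟨Frame.refl _ _, rfl, by simp⟩
  · rintro τ ⟨hf, hw, hc⟩
    refine ⟨hf, hw, List.ext_getElem (by simp [key]) fun c h1 h2 => ?_⟩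
    have h3 : c < (J.sep i).length := by simpa using h1
    simpa [key] using hc ⟨c, h3⟩ (List.mem_finRange _)

/-- Every key with a message is the key of some tuple, so scanning the tuples finds all entries
without traversing the trie. The mark at the end node prevents a second output when several tuples
share a key. -/
theorem reach_emitTuple {j : Fin (Fintype.card {c // J.par c = none})} {s : ℕ}
    (hs : ∀ i, (J.sep i).length ≤ s) {t : Fin (D (Q.rel (rootChild J j).1)).card}
    (hσ : Ready σ t) (hM : Emitted J D M P σ) :
    Reach D (emitTuple J j) σ (7 * s + 20) fun τ => Ready τ t ∧ τ.num 4 = σ.num 4 ∧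
      Emitted J D M (fun j' k => P j' k ∨ j' = j ∧ k = t) τ := by
  have hsc := hs (rootChild J j).1
  refine (Reach.seq (B₁ := s * 3 + 4) (B₂ := 4 * s + 12) ((reach_lookup
    (J := J) (j := (rootChild J j).1) hσ
    fun x hx => (J.mem_sep.1 hx).1).mono (by linarith) fun τ h => ?_)).mono (by linarith)
    fun _ => id
  obtain ⟨hf, hw, h5⟩ := h
  have hr := hσ.frame hf (by simp)
  have hMτ := hM.frame hf (by simp)
  have h4 : τ.num 4 = σ.num 4 := hf.num 4 (by simp)
  rw [hM.val, ← hf.tab] at h5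
  have hlen : (key J D (rootChild J j).1 t (rootChild J j).1).length =
      (J.sep (rootChild J j).1).length := by simp [key]
  -- it remains to see that the current tuple is done
  have hskip : ∀ ρ : State A W, Emitted J D M P ρ →
      (∀ w, M (rootChild J j).1 (key J D (rootChild J j).1 t (rootChild J j).1) = some w →
        key J D (rootChild J j).1 t (rootChild J j).1 ∈ (ρ.out j).map Prod.fst) →
      Emitted J D M (fun j' k => P j' k ∨ j' = j ∧ k = t) ρ := by
    intro ρ hρ hkey
    refine hρ.mono fun j' t' w hP hw' => ?_
    rcases hP with hP | ⟨rfl, ht⟩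
    · exact hρ.done j' t' w hP hw'
    · obtain rfl : t' = t := Fin.ext ht
      exact hkey w hw'
  refine (Reach.ite (B := 4 * s + 11) (fun hb => ?_) fun hb => ?_) <;>
    simp only [Test.Holds, hr.zero] at hb
  · refine (Reach.skip ⟨hr, h4, hskip τ hMτ fun w h => ?_⟩).mono (by omega) fun _ => id
    have := ((hMτ.some_iff _ _ _).1 h).2.1
    rw [← h5] at this
    exact absurd hb this
  · refine (Reach.seq (B₁ := 2) (B₂ := 4 * s + 9) (Reach.ops ?_)).mono (by omega) fun _ => id
    simp only [List.foldl_cons, List.foldl_nil]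
    set τ₁ := (Instr.load 6 5).run D τ with hτ₁
    have hf₁ : Frame {6} τ τ₁ := by
      refine ⟨rfl, rfl, fun r hr => ?_, rfl, fun _ _ => rfl⟩
      simp only [Set.mem_singleton_iff] at hr
      simp [hτ₁, Instr.run, hr]
    have h6 : τ₁.num 6 = τ.num (τ.num 5) := by simp [hτ₁, Instr.run]
    have hsome : M (rootChild J j).1 (key J D (rootChild J j).1 t (rootChild J j).1) =
        some (τ.wt (τ.num 5)) :=
      (hMτ.some_iff _ _ _).2 ⟨hlen, by rwa [← h5], by rw [← h5]⟩
    have hmark := hMτ.mark j _ _ hsome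
    rw [← h5] at hmark
    have hr₁ := hr.frame hf₁ (by simp)
    have hM₁ := hMτ.frame hf₁ (by simp)
    -- Storing the mark at address `N[5]` therefore overwrites no register.
    have h5ge : 10 + Q.numAtoms ≤ τ.num 5 := by
      rw [h5]; exact hMτ.trie.walk_ge (by simp) (by rwa [← h5])
    refine (Reach.ite (B := 4 * s + 8) (fun hb' => ?_) fun hb' => ?_) <;>
      simp only [Test.Holds, hr₁.zero, h6] at hb'
    · have hnew := hmark.1 hb'
      refine (Reach.seq (B₁ := s * 3 + 1) (B₂ := s + 4) ((reach_loadKey hr₁).mono (by linarith)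
        fun τ₂ h => ?_)).mono (by omega) fun _ => id
      obtain ⟨hf₂, hw₂, hval⟩ := h
      refine (Reach.ops ?_).mono (B₁ := 1 + ((J.sep (rootChild J j).1).length + 1) + 1)
        (by omega) fun _ => id
      have hr₂ := hr₁.frame hf₂ (by simp)
      have hM₂ := hM₁.frame hf₂ (by simp)
      have h5₂ : τ₂.num 5 = τ.num 5 := by
        rw [hf₂.num 5 (by simp), hf₁.num 5 (by simp)]
      have htab : τ₂.tab = τ.tab := hf₂.tab.trans hf₁.tab
      have hout : τ₂.out = τ.out := hf₂.out.trans hf₁.out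
      have hwt : τ₂.wt = τ.wt := hw₂
      have h4₂ : τ₂.num 4 = σ.num 4 := by
        rw [hf₂.num 4 (by simp), hf₁.num 4 (by simp), h4]
      set ρ : State A W := { τ₂ with
        num := Function.update τ₂.num (τ.num 5) 1
        out := Function.update τ₂.out j
          (τ₂.out j ++
            [(key J D (rootChild J j).1 t (rootChild J j).1, τ.wt (τ.num 5))]) } with hρ
      have hrun : (List.foldl (fun υ (i : Instr) => i.run D υ) τ₂
          [.store 5 1, .emit j (J.sep (rootChild J j).1).length 1 5]) = ρ := by
        have h5' : (5 : ℕ) ≠ τ.num 5 := by omega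
        have h1' : (1 : ℕ) ≠ τ.num 5 := by omega
        simp only [List.foldl_cons, List.foldl_nil, Instr.run, h5₂, hr₂.one,
          Function.update_of_ne h5', Function.update_of_ne h1', hval, hwt, hρ]
      rw [hrun]
      have hnum : ∀ r, r < 10 → ρ.num r = τ₂.num r := fun r hr => by
        simp only [hρ]; rw [Function.update_of_ne (by omega)]
      have hmem : ∀ (j' : Fin (Fintype.card {c // J.par c = none})) p, p ∈ ρ.out j' ↔
          p ∈ τ₂.out j' ∨ j' = j ∧
            p = (key J D (rootChild J j).1 t (rootChild J j).1, τ.wt (τ.num 5)) := by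
        intro j' p
        by_cases hj : j' = j
        · subst hj; simp [hρ]
        · have : (j' : ℕ) ≠ j := fun h => hj (Fin.ext h)
          simp [hρ, hj, this]
      have hmem' : ∀ (j' : Fin (Fintype.card {c // J.par c = none})) κ,
          κ ∈ (ρ.out j').map Prod.fst ↔
          κ ∈ (τ₂.out j').map Prod.fst ∨
            j' = j ∧ κ = key J D (rootChild J j).1 t (rootChild J j).1 := by
        intro j' κ
        simp only [List.mem_map, hmem]
        aesop
      refine ⟨⟨?_, ?_, ?_, ?_⟩, ?_, hskip ρ ?_ fun w _ => (hmem' _ _).2 (.inr ⟨rfl, rfl⟩)⟩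
      · rw [hnum 0 (by simp), hr₂.zero]
      · rw [hnum 1 (by simp), hr₂.one]
      · rw [hnum 2 (by simp), hr₂.two]
      · rw [hnum 3 (by simp), hr₂.idx]
      · rw [hnum 4 (by simp), h4₂]
      · refine ⟨?_, ?_, ?_, ?_, hM₂.val, hM₂.some_iff, ?_, ?_, ?_, ?_⟩
        · rw [hnum 8 (by simp)]; exact hM₂.trie
        · rw [hnum 0 (by simp), hr₂.zero]
        · rw [hnum 1 (by simp), hr₂.one]
        · rw [hnum 2 (by simp), hr₂.two]
        · intro j' p hp
          rcases (hmem j' p).1 hp with hp | ⟨rfl, rfl⟩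
          · exact hM₂.sound j' p hp
          · exact hsome
        · intro j'
          by_cases hj : j' = j
          · subst hj
            simp only [hρ, Function.update_self, List.map_append, List.map_cons, List.map_nil]
            refine (hM₂.nodup j').append (List.nodup_singleton _) ?_
            rw [List.disjoint_singleton, hout]
            exact hnew
          · have : (j' : ℕ) ≠ j := fun h => hj (Fin.ext h)
            simp only [hρ, Function.update_of_ne this]
            exact hM₂.nodup j'
        · intro j' κ w hw'
          have hs' := (hM₂.some_iff _ _ _).1 hw'
          rw [hmem', not_or, ← hM₂.mark j' κ w hw']
          have htab' : ρ.tab = τ₂.tab := rfl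
          rw [htab']
          by_cases he : walk τ₂.tab (10 + (rootChild J j').1) (Classical.arbitrary A :: κ) =
              τ.num 5
          · rw [he]
            have h1 : ρ.num (τ.num 5) = 1 := by simp [hρ]
            rw [h5, ← htab] at he
            -- Only the key just written ends at the marked node.
            obtain ⟨h2, h3⟩ := hM₂.trie.walk_inj (by omega) (by omega) he hs'.2.1
            have h4 : rootChild J j' = rootChild J j := by
              apply Subtype.ext
              apply Fin.ext
              omega
            have h5 := (rootChild J).injective h4
            have h6 := (List.cons.inj h3).2
            simp [h1, h5, h6]
          · have h1 : ρ.num (walk τ₂.tab (10 + (rootChild J j').1)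
                (Classical.arbitrary A :: κ)) = τ₂.num (walk τ₂.tab (10 + (rootChild J j').1)
                (Classical.arbitrary A :: κ)) := by
              simp only [hρ]; rw [Function.update_of_ne he]
            rw [h1, iff_self_and]
            rintro - ⟨rfl, rfl⟩
            exact he (by rw [htab, h5])
        · intro j' t' w hP hw'
          exact (hmem' _ _).2 (.inl (hM₂.done j' t' w hP hw'))
    · refine (Reach.skip ⟨hr₁, (hf₁.num 4 (by simp)).trans h4, hskip τ₁ hM₁ fun w h => ?_⟩).mono
        (by omega) fun _ => id
      rw [hf₁.out]
      by_contra hnot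
      exact hb' (hmark.2 hnot)

theorem reach_emitAll {s n : ℕ} (hm : Q.numAtoms ≤ s) (ha : ∀ i, Q.arity (Q.rel i) ≤ s)
    (hn : ∀ i, (D (Q.rel i)).card ≤ n) (hM : Represents J σ M) :
    Reach D (emitAll J) σ (s * (n * (7 * s + 20 + 2) + 4) + 1)
      (Emitted J D M fun _ _ => True) := by
  have hsep : ∀ j, (J.sep j).length ≤ s := fun j =>
    (J.length_sep_le j).trans ((CQ.card_atomVars_le j).trans (ha j))
  have hcard : Fintype.card {c // J.par c = none} ≤ s :=
    (Fintype.card_subtype_le fun c => J.par c = none).trans ((Fintype.card_fin _).trans_le hm)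
  refine Reach.mono (B₁ := (List.finRange (Fintype.card {c // J.par c = none})).length *
      (n * (7 * s + 20 + 2) + 4) + 1)
    (Reach.seqList (List.finRange (Fintype.card {c // J.par c = none})) _
      (fun pre τ => Emitted J D M (fun j _ => j ∈ pre) τ) ?_ ?_) (by simp; gcongr) ?_
  · rintro pre j suf - τ hτ
    refine (Reach.forTuples (B := 7 * s + 20) (fun k ρ => ρ.num 3 = k ∧
      ρ.num 4 = (D (Q.rel (rootChild J j).1)).card ∧
      Emitted J D M (fun j' k' => j' ∈ pre ∨ j' = j ∧ k' < k) ρ) ?_ ?_ ?_).mono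
      (by gcongr; exact hn _) ?_
    · rintro k ρ ⟨h3, h4, h⟩
      exact ⟨h.one, h3, h4⟩
    · refine ⟨by simp, by simp, (hτ.mono fun j' t w hP hw => hτ.done j' t w
        (by simpa using hP) hw).frame (S := {3, 4}) ⟨rfl, rfl, ?_, rfl, fun _ _ => rfl⟩ (by simp)⟩
      intro r hr
      simp only [Set.mem_insert_iff, Set.mem_singleton_iff, not_or] at hr
      simp [hr.1, hr.2]
    · rintro k hk ρ ⟨h3, h4, h⟩
      have hready : Ready ρ (⟨k, hk⟩ : Fin (D (Q.rel (rootChild J j).1)).card) :=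
        ⟨h.zero, h.one, h.two, h3⟩
      refine (reach_emitTuple hsep hready h).mono le_rfl fun υ hυ => ?_
      obtain ⟨hr, h4', he⟩ := hυ
      refine ⟨hr.one, hr.idx, by simp, by simp [h4', h4], ?_⟩
      refine (he.mono fun j' t w hP hw => he.done j' t w ?_ hw).frame (S := {3})
        ⟨rfl, rfl, fun r hr => ?_, rfl, fun _ _ => rfl⟩ (by simp)
      · rcases hP with hP | ⟨hP, hlt⟩
        · exact .inl (.inl hP)
        · rcases Nat.lt_succ_iff_lt_or_eq.1 hlt with h | h
          · exact .inl (.inr ⟨hP, h⟩)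
          · exact .inr ⟨hP, h⟩
      · simp only [Set.mem_singleton_iff] at hr
        simp [hr]
    · rintro ρ ⟨-, -, h⟩
      refine h.mono fun j' t w hP hw => h.done j' t w ?_ hw
      rw [List.mem_append, List.mem_singleton] at hP
      rcases hP with hP | rfl
      · exact .inl hP
      · exact .inr ⟨rfl, t.2⟩
  · exact hM.emitted.mono (by simp)
  · exact fun τ hτ => hτ.mono fun j t w _ hw => hτ.done j t w (List.mem_finRange j) hw

/-- By soundness of the messages, every stored key comes from a tuple. This makes the output
complete once all tuples are done, and bounds the number of distinct keys by the number of tuples.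
-/
theorem Emitted.exists_database (h : Emitted J D M (fun _ _ => True) σ)
    (hM : ∀ i, IsMessage J D M i) {n : ℕ} (hn : ∀ i, (D (Q.rel i)).card ≤ n) :
    ∃ D' : Database (fullQuery J) A W, Stores D' M ∧ Outputs σ D' ∧ ∀ j, (D' j).card ≤ n := by
  classical
  choose D' hcard hout using fun j : Fin (Fintype.card {c // J.par c = none}) =>
    exists_wRel (k := (J.sep (rootChild J j).1).length) (σ.out j)
      (fun p hp => ((h.some_iff _ _ _).1 (h.sound j p hp)).1) (h.nodup j)
  have hmem : ∀ (j : Fin (Fintype.card {c // J.par c = none})) p, p ∈ σ.out j ↔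
      ∃ r, (List.ofFn ((D' j).row r), (D' j).weight r) = p := by
    intro j p
    rw [hout j]
    simp [List.mem_ofFn]
  refine ⟨D', ⟨fun j r => h.sound j _ ((hmem j _).2 ⟨r, rfl⟩), fun j κ w hw => ?_⟩, hout,
    fun j => ?_⟩
  · obtain ⟨t, rfl, -⟩ := (hM _).sound κ w hw
    obtain ⟨p, hp, hpk⟩ := List.mem_map.1 (h.done j t w trivial hw)
    obtain ⟨r, rfl⟩ := (hmem j p).1 hp
    have hs := h.sound j _ hp
    dsimp only at hpk hs
    rw [hpk, hw] at hs
    exact ⟨r, hpk, (Option.some.inj hs).symm⟩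
  · refine le_trans ?_ (hn (rootChild J j).1)
    have h1 : ((σ.out j).map Prod.fst).toFinset ⊆ Finset.univ.image fun t =>
        key J D (rootChild J j).1 t (rootChild J j).1 := by
      intro κ hκ
      obtain ⟨p, hp, rfl⟩ := List.mem_map.1 (List.mem_toFinset.1 hκ)
      obtain ⟨t, ht, -⟩ := (hM _).sound _ _ (h.sound j p hp)
      exact Finset.mem_image.2 ⟨t, Finset.mem_univ _, ht⟩
    have h2 := Finset.card_le_card h1
    rw [List.toFinset_card_of_nodup (h.nodup j), List.length_map] at h2
    exact (hcard j).trans_le (h2.trans (Finset.card_image_le.trans (by simp)))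

end Output

end RankedCQ

/-! ### The assembled program and its constant -/

theorem mainTheorem5 (s : ℕ) :
    ∃ C : ℕ, ∀ (Z : Finset ℕ) (Q : CQ Z), Q.IsFreeConnex → Q.SizeAtMost s →
      ∃ (Q' : CQ Z) (p : Prog), Q'.IsFull ∧ Q'.SizeAtMost C ∧
        ∀ (A : Type*) (W : Type*) [Nonempty A] [SelectiveDioid W] (D : Database Q A W) (n : ℕ),
          (∀ i, (D (Q.rel i)).card ≤ n) →
          ∃ D' : Database Q' A W,
            (∀ j, (D' j).card ≤ C * n) ∧
            Computes p D D' (C * (n + 1)) ∧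
            ∀ L : List ((Z → A) × W),
              IsRankedEnumeration Q D L ↔ IsRankedEnumeration Q' D' L := by
  set K := 3 * s * s + 26 * s + 20 + 2 with hK
  set E := 7 * s + 20 + 2 with hE
  -- `K` and `E` bound the cost per tuple, loop included, of computing and of writing messages; each
  -- of at most `s` loops adds `4`, and `6` collects the fixed costs. The last `s` makes the
  -- constant bound the size of the full query as well.
  refine ⟨s * (K + 4) + s * (E + 4) + 6 + s, fun Z Q hQ hs => ?_⟩
  obtain ⟨J⟩ := exists_rootedJoinTree hQ.2
  have hle : s ≤ s * (K + 4) + s * (E + 4) + 6 + s := Nat.le_add_left _ _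
  have hsize := fullQuery_sizeAtMost J hs
  refine ⟨fullQuery J, .seq (processAll J) (emitAll J), fullQuery_isFull J,
    ⟨hsize.1.trans hle, fun i => (hsize.2 i).trans hle⟩, ?_⟩
  intro A W _ _ D n hn
  obtain ⟨σ, t, hexec, ht, M, hM, hmsg⟩ := reach_processAll (J := J) hs.1 hs.2 hn
  obtain ⟨τ, t', hexec', ht', hem⟩ := reach_emitAll hs.1 hs.2 hn hM
  obtain ⟨D', hD', hout, hcard⟩ := hem.exists_database hmsg hn
  refine ⟨D', fun j => (hcard j).trans (Nat.le_mul_of_pos_left n (by omega)),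
    ⟨τ, t + t', ?_, .seq hexec hexec', hout⟩, isRankedEnumeration_iff hmsg hD'⟩
  refine (Nat.add_le_add ht ht').trans ?_
  rw [← hK, ← hE]
  nlinarith [Nat.zero_le (s * n), Nat.zero_le (s * K), Nat.zero_le (s * E), Nat.zero_le n]
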